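/- Let $\mathcal P_2=\{(x,y)\in\mathbb R^2 : |y|\le 1-x^2\}$, let $|\mathcal P_2|$ be its area, and for real $R>0$ let $\mathcal N_2(R)=\#\{n\in\mathbb Z^2 : R^{-1}n\in\mathcal P_2\}$. Then for every real $c<\sqrt2$, $$\mathcal N_2(R)-|\mathcal P_2|R^2=\Omega_-\!\left(R^{1/2}\exp\!\left(\frac{c\sqrt{\log R}}{\log\log R}\right)\right)\qquad(R\to\infty),$$ where $f=\Omega_-(g)$ means that the negative part $f^-=\max(-f,0)$ of $f$ is not $o(g)$, that is, $f^-(R)/g(R)$ does not tend to $0$ as $R\to\infty$. -/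

import Mathlib

open Asymptotics Filter MeasureTheory

/-- The parabolic region `|y| ≤ 1 - x ^ 2` of the plane. -/
def parabolicRegion : Set (ℝ × ℝ) := {p | |p.2| ≤ 1 - p.1 ^ 2}

/-- The number of lattice points `n ∈ ℤ²` with `R⁻¹ n ∈ K`. -/
noncomputable def latticeCount (K : Set (ℝ × ℝ)) (R : ℝ) : ℕ :=
  {n : ℤ × ℤ | R⁻¹ • ((n.1 : ℝ), (n.2 : ℝ)) ∈ K}.ncard

/-- `f = Ω₋(g)` as the variable tends to `+∞`: the negative part of `f` is not `o(g)`. -/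
def IsOmegaMinus (f g : ℝ → ℝ) : Prop :=
  ¬ (fun R : ℝ => (f R)⁻) =o[atTop] g

/-! Summing over columns, the discrepancy is `-2 ∑ ψ(R - m²/R)` up to small terms, with `ψ` the
sawtooth, so it suffices to find `R` at which this sum over `|m| ≤ R` is large and positive.

`πψ` is the boundary value of `Im log(1 - e(w))`, harmonic in the upper half-plane, and `R ↦ R -
m²/R` preserves that half-plane. Hence the Poisson integral of `ψ(R - m²/R)` at `z` is `π⁻¹ Im log(1
- e(z - m²/z))` (`integral_sawtooth_cayley`), and a large Poisson mean of the sum forces a large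
value nearby (`exists_sum_sawtooth_gt`). At `z = q²/(q - iη)`, close to `q + iη`, the `n`-th
harmonic is exactly a Gauss sum `∑ e(-nm²/q)` with a Gaussian weight. Reciprocity
(`quadratic_reciprocity_sum`, `weightedGaussSum_approx`) turns it into `√(q/2n) e(-1/8)` times a sum
of `e(qs²/4n)` over `4n` values of `s`.

Now average over `q = Qk`, `k ≤ Y²`, with `η = 1/Y`. If `n ∣ Q`, every even `s` gives `e(qs²/4n) =
1`, and `-Im e(-1/8) > 0`; all other terms are geometric sums and lose little. Some `q` thus has
Poisson mean at least `√q (c ∑ e^{-1/2} - C)`, over the divisors `e ≤ Y` of `Q`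
(`exists_tsum_dualIm_ge`, `exists_discrepancy_le`).

Finally take `Q` a primorial and `Y = 4^π(N)`. The divisor sum is about `∏ (1 + p^{-1/2})`, and
partial summation against Chebyshev's lower bound `θ(N) ≥ aN`, `a < log 2`, gives `∑ p^{-1/2} ≥ 2√a
√θ(N) / log N` up to small terms. Since `log R ~ θ(N)` and `2√(log 2) > √2`, the constant `√2` is
reached without the prime number theorem. -/

open scoped Real Topology

/-! ### Theta series and Gaussian means of periodic functions. -/

/-- The additive character `e(x) = exp(2πix)`. -/
noncomputable def expTwoPi (x : ℝ) : ℂ := Complex.exp (2 * π * x * Complex.I)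

lemma expTwoPi_add (x y : ℝ) : expTwoPi (x + y) = expTwoPi x * expTwoPi y := by
  rw [expTwoPi, expTwoPi, expTwoPi, ← Complex.exp_add]
  push_cast
  ring_nf

lemma expTwoPi_int (n : ℤ) : expTwoPi n = 1 := by
  rw [expTwoPi, ← Complex.exp_int_mul_two_pi_mul_I n]
  push_cast
  ring_nf

lemma expTwoPi_zero : expTwoPi 0 = 1 := by simp [expTwoPi]

lemma norm_expTwoPi (x : ℝ) : ‖expTwoPi x‖ = 1 := by
  have : (2 * π * x * Complex.I : ℂ) = ((2 * π * x : ℝ) : ℂ) * Complex.I := by push_cast; ring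
  rw [expTwoPi, this, Complex.norm_exp_ofReal_mul_I]

lemma expTwoPi_add_int (x : ℝ) (n : ℤ) : expTwoPi (x + n) = expTwoPi x := by
  rw [expTwoPi_add, expTwoPi_int, mul_one]

lemma expTwoPi_nat_mul (n : ℕ) (x : ℝ) : expTwoPi (n * x) = expTwoPi x ^ n := by
  rw [expTwoPi, expTwoPi, ← Complex.exp_nat_mul]
  push_cast
  ring_nf

lemma expTwoPi_neg (x : ℝ) : expTwoPi (-x) = (expTwoPi x)⁻¹ := by
  rw [expTwoPi, expTwoPi, ← Complex.exp_neg]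
  push_cast
  ring_nf

/-- Sums of a periodic function over complete periods agree. -/
lemma sum_Ico_eq_of_periodic {a : ℤ → ℂ} {N : ℕ} (ha : ∀ m, a (m + N) = a m) (x : ℤ) :
    ∑ m ∈ Finset.Ico x (x + N), a m = ∑ r ∈ Finset.Ico (0 : ℤ) N, a r := by
  have step : ∀ x : ℤ, ∑ m ∈ Finset.Ico (x + 1) (x + 1 + N), a m
      = ∑ m ∈ Finset.Ico x (x + N), a m := by
    intro x
    rcases Nat.eq_zero_or_pos N with rfl | hN
    · simp
    have h1 : Finset.Ico x (x + N) = insert x (Finset.Ico (x + 1) (x + N)) := by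
      ext; simp; omega
    have h2 : Finset.Ico (x + 1) (x + 1 + N) = insert (x + N) (Finset.Ico (x + 1) (x + N)) := by
      ext; simp; omega
    rw [h1, h2, Finset.sum_insert (by simp), Finset.sum_insert (by simp), ha]
  induction x using Int.induction_on with
  | zero => simp
  | succ i ih => rw [step, ih]
  | pred i ih => rw [← step, sub_add_cancel, ih]

lemma hasSum_int_residue {f : ℤ → ℂ} {N : ℕ} (hN : 0 < N) (hf : Summable f) :
    ∑' m, f m = ∑ r ∈ Finset.Ico (0 : ℤ) N, ∑' l : ℤ, f (N * l + r) := by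
  have : NeZero N := ⟨hN.ne'⟩
  have h1 : ∑' m, f m = ∑' p : ℤ × Fin N, f ((Int.divModEquiv N).symm p) :=
    ((Int.divModEquiv N).symm.tsum_eq f).symm
  have h2 : Summable fun p : ℤ × Fin N => f ((Int.divModEquiv N).symm p) :=
    (Int.divModEquiv N).symm.summable_iff.2 hf
  have h3 : Summable fun p : Fin N × ℤ => f ((Int.divModEquiv N).symm p.swap) :=
    (Equiv.prodComm (Fin N) ℤ).summable_iff.2 h2
  rw [h1, ← (Equiv.prodComm (Fin N) ℤ).tsum_eq, Summable.tsum_prod (by exact h3), tsum_fintype]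
  have h4 : ∑ r ∈ Finset.Ico (0 : ℤ) N, ∑' l : ℤ, f (N * l + r)
      = ∑ r ∈ Finset.range N, ∑' l : ℤ, f (N * l + (r : ℤ)) := by
    symm
    refine Finset.sum_bij (fun r _ => (r : ℤ)) (by simp) (by simp) ?_ (by simp)
    intro b hb
    simp only [Finset.mem_Ico] at hb
    exact ⟨b.toNat, by simp; omega, by simp; omega⟩
  rw [h4, ← Fin.sum_univ_eq_sum_range (fun r => ∑' l : ℤ, f (N * l + (r : ℤ)))]
  refine Finset.sum_congr rfl fun r _ => tsum_congr fun l => ?_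
  simp [Int.divModEquiv]
  ring_nf

lemma summable_gaussian_shift {w : ℂ} (hw : 0 < w.re) (b : ℝ) :
    Summable fun m : ℤ => Complex.exp (-π * w * ((m : ℂ) - b) ^ 2) := by
  have h := (summable_jacobiTheta₂_term_iff (-(Complex.I * w * b)) (Complex.I * w)).2 (by simpa using hw)
  refine (h.mul_left (Complex.exp (-π * w * b ^ 2))).congr fun m => ?_
  rw [jacobiTheta₂_term, ← Complex.exp_add]
  congr 1
  linear_combination (π * m ^ 2 * w - 2 * π * m * w * b : ℂ) * Complex.I_sq

/-- Poisson summation for a Gaussian along a residue class. -/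
lemma tsum_gaussian_residue {w : ℂ} (hw : 0 < w.re) {N : ℕ} (hN : 0 < N) (r : ℤ) (b : ℝ) :
    ∑' l : ℤ, Complex.exp (-π * w * (((N * l + r : ℤ) : ℂ) - b) ^ 2)
      = 1 / (w * (N : ℝ) ^ 2) ^ (1 / 2 : ℂ) *
        ∑' l : ℤ, expTwoPi (l * (r - b) / N) * Complex.exp (-π / (w * N ^ 2) * l ^ 2) := by
  have hN' : (N : ℂ) ≠ 0 := by exact_mod_cast hN.ne'
  have hw0 : w ≠ 0 := by rintro rfl; simp at hw
  have hre : 0 < (w * (N : ℂ) ^ 2).re := by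
    have : (w * (N : ℂ) ^ 2) = w * ((N ^ 2 : ℝ) : ℂ) := by push_cast; ring
    rw [this, Complex.re_mul_ofReal]
    positivity
  have key := Complex.tsum_exp_neg_quadratic hre (-w * N * (r - b))
  have h1 : ∀ l : ℤ, Complex.exp (-π * w * (((N * l + r : ℤ) : ℂ) - b) ^ 2)
      = Complex.exp (-π * w * (r - b) ^ 2) *
        Complex.exp (-π * (w * N ^ 2) * l ^ 2 + 2 * π * (-w * N * (r - b)) * l) := by
    intro l
    rw [← Complex.exp_add]
    push_cast
    ring_nf
  simp_rw [h1]
  rw [tsum_mul_left, key, mul_left_comm, ← tsum_mul_left]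
  push_cast
  congr 1
  refine tsum_congr fun l => ?_
  rw [expTwoPi, ← Complex.exp_add, ← Complex.exp_add]
  congr 1
  push_cast
  field_simp
  linear_combination (-(N ^ 2 * w ^ 2 * (r - b) ^ 2 : ℂ)) * Complex.I_sq

/-- On the dual side of Poisson summation every term with `l ≠ 0` decays like `exp(-const·l²/ε)`, so
only `l = 0` survives. The majorant is obtained from `1/ε ≥ 1`. -/
lemma tendsto_tsum_theta_one {v : ℝ → ℂ} {v₀ : ℝ} (hv₀ : 0 < v₀)
    (hv : Tendsto v (𝓝[>] 0) (𝓝 (v₀ : ℂ))) {N : ℕ} (hN : 0 < N) (x : ℝ) :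
    Tendsto (fun ε : ℝ => ∑' l : ℤ, expTwoPi (l * x) *
      Complex.exp (-π / ((ε * v ε) * N ^ 2) * l ^ 2)) (𝓝[>] 0) (𝓝 1) := by
  have hN' : (0 : ℝ) < N := by exact_mod_cast hN
  have hinv : Tendsto (fun ε => ((v ε)⁻¹).re) (𝓝[>] 0) (𝓝 (v₀⁻¹)) := by
    have h := (hv.inv₀ (by exact_mod_cast hv₀.ne'))
    have := (Complex.continuous_re.tendsto _).comp h
    rwa [← Complex.ofReal_inv, Complex.ofReal_re] at this
  set c : ℝ := v₀⁻¹ / 2 with hc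
  have hc0 : 0 < c := by positivity
  have hev : ∀ᶠ ε in 𝓝[>] (0 : ℝ), c ≤ ((v ε)⁻¹).re :=
    hinv.eventually (eventually_ge_nhds (by rw [hc]; linarith [inv_pos.2 hv₀]))
  have hre : ∀ ε : ℝ, ∀ l : ℤ, (-π / ((ε * v ε) * N ^ 2) * l ^ 2 : ℂ).re
      = -(π * l ^ 2 / N ^ 2) * ε⁻¹ * ((v ε)⁻¹).re := by
    intro ε l
    have : (-π / ((ε * v ε) * N ^ 2) * l ^ 2 : ℂ)
        = ((-(π * l ^ 2 / N ^ 2) * ε⁻¹ : ℝ) : ℂ) * (v ε)⁻¹ := by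
      push_cast
      simp only [div_eq_mul_inv, mul_inv]
      ring
    rw [this, Complex.re_ofReal_mul]
  have hnorm : ∀ ε : ℝ, ∀ l : ℤ, ‖expTwoPi (l * x) *
      Complex.exp (-π / ((ε * v ε) * N ^ 2) * l ^ 2)‖
      = Real.exp (-(π * l ^ 2 / N ^ 2) * ε⁻¹ * ((v ε)⁻¹).re) := by
    intro ε l
    rw [norm_mul, norm_expTwoPi, one_mul, Complex.norm_exp, hre]
  have hbd : Summable fun l : ℤ => Real.exp (-(π * l ^ 2 / N ^ 2) * c) := by
    have := (summable_gaussian_shift (w := ((c / N ^ 2 : ℝ) : ℂ))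
      (by rw [Complex.ofReal_re]; positivity) 0).norm
    refine this.congr fun l => ?_
    rw [Complex.norm_exp]
    congr 1
    have : (-π * ((c / N ^ 2 : ℝ) : ℂ) * ((l : ℂ) - (0 : ℝ)) ^ 2)
      = ((-(π * l ^ 2 / N ^ 2) * c : ℝ) : ℂ) := by push_cast; ring
    rw [this, Complex.ofReal_re]
  have hlim : ∀ l : ℤ, Tendsto (fun ε : ℝ => expTwoPi (l * x) *
      Complex.exp (-π / ((ε * v ε) * N ^ 2) * l ^ 2)) (𝓝[>] 0) (𝓝 (if l = 0 then 1 else 0)) := by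
    intro l
    split_ifs with hl
    · subst hl
      simp [expTwoPi_zero]
    · rw [tendsto_zero_iff_norm_tendsto_zero]
      simp_rw [hnorm]
      refine Real.tendsto_exp_atBot.comp ?_
      have hl2 : 0 < π * (l : ℝ) ^ 2 / N ^ 2 := by
        have : (0 : ℝ) < (l : ℝ) ^ 2 := by positivity
        positivity
      have h := (tendsto_inv_nhdsGT_zero (𝕜 := ℝ)).const_mul_atTop_of_neg (neg_lt_zero.2 hl2)
      exact h.atBot_mul_pos (inv_pos.2 hv₀) hinv
  have := tendsto_tsum_of_dominated_convergence hbd hlim (by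
    filter_upwards [hev, Ioo_mem_nhdsGT one_pos] with ε hε hε0 l
    rw [hnorm]
    apply Real.exp_le_exp.2
    have hl2 : 0 ≤ π * (l : ℝ) ^ 2 / N ^ 2 := by positivity
    have h1 : 1 ≤ ε⁻¹ := (one_le_inv₀ hε0.1).2 hε0.2.le
    have h2 : c ≤ ε⁻¹ * ((v ε)⁻¹).re := by nlinarith
    nlinarith [mul_le_mul_of_nonneg_left h2 hl2])
  simpa using this

lemma cpow_half_ofReal_mul {r : ℝ} (hr : 0 < r) {x : ℂ} (hx : x ≠ 0) :
    ((r : ℂ) * x) ^ (1 / 2 : ℂ) = √r * x ^ (1 / 2 : ℂ) := by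
  have hr' : (r : ℂ) ≠ 0 := by exact_mod_cast hr.ne'
  have h2 : (√r : ℂ) = (r : ℂ) ^ (1 / 2 : ℂ) := by
    rw [Real.sqrt_eq_rpow, Complex.ofReal_cpow hr.le]
    norm_num
  rw [h2, Complex.cpow_def_of_ne_zero (mul_ne_zero hr' hx), Complex.cpow_def_of_ne_zero hr',
    Complex.cpow_def_of_ne_zero hx, ← Complex.exp_add, Complex.log_ofReal_mul hr hx,
    Complex.ofReal_log hr.le]
  ring_nf

lemma I_cpow_half : Complex.I ^ (1 / 2 : ℂ) = expTwoPi (1 / 8) := by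
  rw [Complex.cpow_def_of_ne_zero Complex.I_ne_zero, Complex.log_I, expTwoPi]
  push_cast
  ring_nf

/-- The Gaussian mean of a periodic function is its average. -/
lemma tendsto_gaussian_mean {a : ℤ → ℂ} {N : ℕ} (hN : 0 < N) (ha : ∀ m, a (m + N) = a m) (b : ℝ)
    {v : ℝ → ℂ} {v₀ : ℝ} (hv₀ : 0 < v₀) (hv : Tendsto v (𝓝[>] 0) (𝓝 (v₀ : ℂ))) :
    Tendsto (fun ε : ℝ => (√ε : ℂ) * ∑' m : ℤ, a m * Complex.exp (-π * (ε * v ε) * (m - b) ^ 2))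
      (𝓝[>] 0) (𝓝 ((∑ r ∈ Finset.Ico (0 : ℤ) N, a r) / (N * √v₀))) := by
  have hN' : (0 : ℝ) < N := by exact_mod_cast hN
  have hper : ∀ (r l : ℤ), a (N * l + r) = a r := by
    intro r l
    induction l using Int.induction_on with
    | zero => simp
    | succ i ih => rw [← ih, ← ha (N * i + r)]; congr 1; ring
    | pred i ih => rw [← ih, ← ha (N * (-i - 1) + r)]; congr 1; ring
  have hbound : ∃ C, ∀ m, ‖a m‖ ≤ C := by
    refine ⟨∑ r ∈ Finset.Ico (0 : ℤ) N, ‖a r‖, fun m => ?_⟩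
    have h := hper (m % N) (m / N)
    rw [Int.mul_ediv_add_emod] at h
    rw [h]
    have hm : m % N ∈ Finset.Ico (0 : ℤ) N := by
      simp only [Finset.mem_Ico]
      exact ⟨Int.emod_nonneg _ (by omega), Int.emod_lt_of_pos _ (by omega)⟩
    exact Finset.single_le_sum (f := fun r => ‖a r‖) (fun _ _ => norm_nonneg _) hm
  obtain ⟨C, hC⟩ := hbound
  have hpos : ∀ᶠ ε in 𝓝[>] (0 : ℝ), 0 < (v ε).re := by
    have := (Complex.continuous_re.tendsto _).comp hv
    rw [Complex.ofReal_re] at this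
    exact this.eventually (eventually_gt_nhds hv₀)
  have hform : ∀ᶠ ε in 𝓝[>] (0 : ℝ),
      ∑ r ∈ Finset.Ico (0 : ℤ) N, a r * ((1 / (N * (v ε) ^ (1 / 2 : ℂ))) *
        ∑' l : ℤ, expTwoPi (l * ((r - b) / N)) *
          Complex.exp (-π / ((ε * v ε) * N ^ 2) * l ^ 2)) =
      (√ε : ℂ) * ∑' m : ℤ, a m * Complex.exp (-π * (ε * v ε) * (m - b) ^ 2) := by
    filter_upwards [hpos, self_mem_nhdsWithin] with ε hε (hε0 : 0 < ε)
    have hw : 0 < ((ε : ℂ) * v ε).re := by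
      rw [Complex.re_ofReal_mul]; positivity
    have hsum : Summable fun m : ℤ => a m * Complex.exp (-π * (ε * v ε) * ((m : ℂ) - b) ^ 2) := by
      refine Summable.of_norm_bounded ((summable_gaussian_shift hw b).norm.mul_left C) fun m => ?_
      rw [norm_mul]
      exact mul_le_mul_of_nonneg_right (hC m) (norm_nonneg _)
    rw [hasSum_int_residue hN hsum, Finset.mul_sum]
    refine Finset.sum_congr rfl fun r _ => ?_
    simp_rw [hper]
    rw [tsum_mul_left, tsum_gaussian_residue hw hN]
    have hcp : ((ε : ℂ) * v ε * (N : ℝ) ^ 2) ^ (1 / 2 : ℂ)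
        = √ε * (N * (v ε) ^ (1 / 2 : ℂ)) := by
      have h1 : ((ε : ℂ) * v ε * (N : ℝ) ^ 2) = ((ε * N ^ 2 : ℝ) : ℂ) * v ε := by push_cast; ring
      have hv0 : v ε ≠ 0 := by intro h; simp [h] at hε
      rw [h1, cpow_half_ofReal_mul (by positivity) hv0, Real.sqrt_mul hε0.le,
        Real.sqrt_sq hN'.le]
      push_cast
      ring
    rw [hcp]
    have hs : (√ε : ℂ) ≠ 0 := by exact_mod_cast (Real.sqrt_pos.2 hε0).ne'
    simp_rw [mul_div_assoc]
    generalize (∑' l : ℤ, expTwoPi (l * ((r - b) / N)) *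
      Complex.exp (-π / (ε * v ε * N ^ 2) * l ^ 2)) = T
    field_simp
  refine Tendsto.congr' hform ?_
  have hcv : Tendsto (fun ε => 1 / (N * (v ε) ^ (1 / 2 : ℂ))) (𝓝[>] 0)
      (𝓝 (1 / (N * √v₀))) := by
    have h1 : Tendsto (fun ε => (v ε) ^ (1 / 2 : ℂ)) (𝓝[>] 0) (𝓝 ((v₀ : ℂ) ^ (1 / 2 : ℂ))) :=
      (continuousAt_cpow_const (Or.inl (by simpa using hv₀))).tendsto.comp hv
    have h2 : (v₀ : ℂ) ^ (1 / 2 : ℂ) = √v₀ := by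
      rw [Real.sqrt_eq_rpow, Complex.ofReal_cpow hv₀.le]
      norm_num
    rw [h2] at h1
    refine tendsto_const_nhds.div (h1.const_mul _) ?_
    have : (√v₀ : ℂ) ≠ 0 := by exact_mod_cast (Real.sqrt_pos.2 hv₀).ne'
    have : (N : ℂ) ≠ 0 := by exact_mod_cast hN.ne'
    positivity
  have h := tendsto_finsetSum (Finset.Ico (0 : ℤ) N) fun r _ =>
    (hcv.mul (tendsto_tsum_theta_one hv₀ hv hN ((r - b) / N))).const_mul (a r)
  convert h using 2
  rw [Finset.sum_div]
  refine Finset.sum_congr rfl fun r _ => ?_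
  ring

/-! ### Reciprocity for quadratic Gauss sums with a linear term. -/

/-- The generalized Landsberg-Schaar relation. -/
lemma quadratic_reciprocity_sum {n q : ℕ} (hn : 0 < n) (hq : 0 < q) (j : ℤ) :
    ∑ m ∈ Finset.Ico (-(q : ℤ)) q, expTwoPi (-(n * m ^ 2 / q) + j * m / (2 * q))
      = √(q / (2 * n)) * expTwoPi (-1 / 8) *
        ∑ s ∈ Finset.Ico (-(2 * n : ℤ)) (2 * n), expTwoPi (q * (s - j / (2 * q)) ^ 2 / (4 * n)) := by
  have hn' : (0 : ℝ) < n := by exact_mod_cast hn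
  have hq' : (0 : ℝ) < q := by exact_mod_cast hq
  have hnC : (n : ℂ) ≠ 0 := by exact_mod_cast hn.ne'
  have hqC : (q : ℂ) ≠ 0 := by exact_mod_cast hq.ne'
  set a : ℤ → ℂ := fun m => expTwoPi (-(n * m ^ 2 / q) + j * m / (2 * q)) with ha
  set a' : ℤ → ℂ := fun s => expTwoPi (q * (s - j / (2 * q)) ^ 2 / (4 * n)) with ha'
  have hap : ∀ m, a (m + (2 * q : ℕ)) = a m := by
    intro m
    rw [ha]
    simp only
    refine (congrArg expTwoPi ?_).trans (expTwoPi_add_int _ (-(4 * n * m + 4 * n * q) + j))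
    push_cast
    field_simp
    ring
  have hap' : ∀ s, a' (s + (4 * n : ℕ)) = a' s := by
    intro s
    rw [ha']
    simp only
    refine (congrArg expTwoPi ?_).trans (expTwoPi_add_int _ (2 * q * s + 4 * n * q - j))
    push_cast
    field_simp
    ring
  have e1 := sum_Ico_eq_of_periodic hap (-q)
  have e2 := sum_Ico_eq_of_periodic hap' (-(2 * n))
  rw [show (-(q : ℤ) + (2 * q : ℕ)) = q by push_cast; ring] at e1
  rw [show (-(2 * n : ℤ) + (4 * n : ℕ)) = 2 * n by push_cast; ring] at e2
  rw [e1, e2]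
  -- The theta transformation is applied at `α = ε + 2in/q`, and `ε → 0+`. Since `1/α = εv -
  -- iq/(2n)` with `v → (q/2n)²`, both sides times `√ε` are Gaussian means of periodic functions,
  -- and their limits are the two complete sums.
  set α : ℝ → ℂ := fun ε => ε + 2 * n / q * Complex.I with hα
  set v : ℝ → ℂ := fun ε => Complex.I * q / (2 * n) / α ε with hv
  have hα0 : Tendsto α (𝓝[>] 0) (𝓝 (2 * n / q * Complex.I)) := by
    have : Continuous α := by fun_prop
    have := this.tendsto 0
    simp only [hα, Complex.ofReal_zero, zero_add] at this
    exact this.mono_left nhdsWithin_le_nhds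
  have hαne : (2 * n / q * Complex.I : ℂ) ≠ 0 := by
    simp [hnC, hqC]
  have hvlim : Tendsto v (𝓝[>] 0) (𝓝 (((q / (2 * n)) ^ 2 : ℝ) : ℂ)) := by
    have h := (tendsto_const_nhds (x := (Complex.I * q / (2 * n) : ℂ))).div hα0 hαne
    refine Eq.subst (motive := fun x => Tendsto v (𝓝[>] 0) (𝓝 x)) ?_ h
    have := Complex.I_ne_zero
    push_cast
    field_simp
  have L1 := tendsto_gaussian_mean (a := a) (by omega : 0 < 2 * q) hap 0 one_pos
    (v := fun _ => 1) (by simp)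
  have L2 := tendsto_gaussian_mean (a := a') (by omega : 0 < 4 * n) hap' (j / (2 * q))
    (by positivity) hvlim
  have hαc : Tendsto (fun ε => 1 / (α ε) ^ (1 / 2 : ℂ)) (𝓝[>] 0)
      (𝓝 (1 / (2 * n / q * Complex.I) ^ (1 / 2 : ℂ))) := by
    refine tendsto_const_nhds.div
      ((continuousAt_cpow_const (Or.inr ?_)).tendsto.comp hα0) ?_
    · have : (2 * n / q * Complex.I : ℂ) = ((2 * n / q : ℝ) : ℂ) * Complex.I := by push_cast; rfl
      rw [this, Complex.im_ofReal_mul, Complex.I_im]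
      positivity
    · simp [Complex.cpow_eq_zero_iff, hnC, hqC]
  have heq : ∀ᶠ ε in 𝓝[>] (0 : ℝ), 1 / (α ε) ^ (1 / 2 : ℂ) *
      ((√ε : ℂ) * ∑' m : ℤ, a' m * Complex.exp (-π * (ε * v ε) * (m - (j / (2 * q) : ℝ)) ^ 2))
      = (√ε : ℂ) * ∑' m : ℤ, a m * Complex.exp (-π * (ε * 1) * (m - (0 : ℝ)) ^ 2) := by
    filter_upwards [self_mem_nhdsWithin] with ε (hε : 0 < ε)
    have hre : 0 < (α ε).re := by
      have : α ε = ε + ((2 * n / q : ℝ) : ℂ) * Complex.I := by simp only [hα]; push_cast; rfl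
      rw [this]
      simpa using hε
    have hαε : α ε ≠ 0 := by intro h; simp [h] at hre
    have key := Complex.tsum_exp_neg_quadratic hre (Complex.I * j / (2 * q))
    rw [mul_left_comm]
    congr 1
    convert key.symm using 1
    · congr 1
      refine tsum_congr fun m => ?_
      simp only [ha', expTwoPi]
      rw [← Complex.exp_add]
      congr 1
      have h1 : (ε * v ε : ℂ) = 1 / α ε + Complex.I * q / (2 * n) := by
        simp only [hv]
        field_simp
        simp only [hα]
        field_simp
        linear_combination (-2 * n : ℂ) * Complex.I_sq
      rw [h1]
      push_cast
      field_simp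
      linear_combination (32 * q * m * j * n + 8 * j ^ 2 * n * (Complex.I ^ 2 - 1) : ℂ) * Complex.I_sq
    · refine tsum_congr fun m => ?_
      simp only [ha, expTwoPi]
      rw [← Complex.exp_add]
      congr 1
      simp only [hα]
      push_cast
      field_simp
      ring
  have hfin := tendsto_nhds_unique L1 ((hαc.mul L2).congr' heq)
  have hc : (2 * n / q * Complex.I : ℂ) ^ (1 / 2 : ℂ) = √(2 * n / q) * expTwoPi (1 / 8) := by
    have : (2 * n / q * Complex.I : ℂ) = ((2 * n / q : ℝ) : ℂ) * Complex.I := by push_cast; rfl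
    rw [this, cpow_half_ofReal_mul (by positivity) Complex.I_ne_zero, I_cpow_half]
  rw [hc, Real.sqrt_sq (by positivity), Real.sqrt_one] at hfin
  have h8 : expTwoPi (-1 / 8) = (expTwoPi (1 / 8))⁻¹ := by rw [← expTwoPi_neg]; norm_num
  have h80 : expTwoPi (1 / 8) ≠ 0 := by
    rw [← norm_ne_zero_iff, norm_expTwoPi]; exact one_ne_zero
  have hsq : (√(q / (2 * n)) : ℂ) = (√(2 * n / q) : ℂ)⁻¹ := by
    rw [← Complex.ofReal_inv, ← Real.sqrt_inv, inv_div]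
  have hs0 : (√(2 * n / q) : ℂ) ≠ 0 := by
    exact_mod_cast (Real.sqrt_pos.2 (by positivity : 0 < 2 * (n : ℝ) / q)).ne'
  rw [h8, hsq]
  push_cast at hfin
  push_cast
  field_simp at hfin ⊢
  linear_combination (1 / 4 : ℂ) * hfin

/-! ### Fourier series of the Gaussian weight on `[-1, 1]`. -/

/-- The Gaussian weight `exp(-2πκu²)`. -/
noncomputable def gaussWeight (κ u : ℝ) : ℝ := Real.exp (-(2 * π * κ) * u ^ 2)

lemma gaussWeight_neg (κ u : ℝ) : gaussWeight κ (-u) = gaussWeight κ u := by simp [gaussWeight]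

lemma gaussWeight_pos (κ u : ℝ) : 0 < gaussWeight κ u := Real.exp_pos _

lemma gaussWeight_le_one {κ : ℝ} (hκ : 0 ≤ κ) (u : ℝ) : gaussWeight κ u ≤ 1 := by
  rw [gaussWeight, Real.exp_le_one_iff]
  have : 0 ≤ 2 * π * κ * u ^ 2 := by positivity
  linarith

lemma norm_fourierCoeffOn_le {f : ℝ → ℂ} {C : ℝ} (hf : ∀ x ∈ Set.Icc (-1 : ℝ) 1, ‖f x‖ ≤ C)
    (j : ℤ) : ‖fourierCoeffOn (show (-1 : ℝ) < 1 by norm_num) f j‖ ≤ C := by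
  rw [fourierCoeffOn_eq_integral]
  have h := intervalIntegral.norm_integral_le_of_norm_le_const (a := (-1 : ℝ)) (b := 1) (C := C)
    (f := fun x => fourier (-j) (x : AddCircle (1 - (-1 : ℝ))) • f x) (by
      intro x hx
      rw [Set.uIoc_of_le (by norm_num)] at hx
      rw [norm_smul, fourier_apply, Circle.norm_coe, one_mul]
      exact hf x ⟨hx.1.le, hx.2⟩)
  rw [norm_smul]
  norm_num at h ⊢
  linarith

lemma hasDerivAt_gaussWeight (κ x : ℝ) :
    HasDerivAt (gaussWeight κ) (-(4 * π * κ * x) * gaussWeight κ x) x := by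
  have h := ((hasDerivAt_pow 2 x).const_mul (-(2 * π * κ))).exp
  refine h.congr_deriv ?_
  simp only [gaussWeight]
  push_cast
  ring

lemma hasDerivAt_deriv_gaussWeight (κ x : ℝ) :
    HasDerivAt (fun x => -(4 * π * κ * x) * gaussWeight κ x)
      ((16 * π ^ 2 * κ ^ 2 * x ^ 2 - 4 * π * κ) * gaussWeight κ x) x := by
  have h := (((hasDerivAt_id x).const_mul (-(4 * π * κ)))).mul (hasDerivAt_gaussWeight κ x)
  refine (h.congr_deriv ?_).congr_of_eventuallyEq (Eventually.of_forall fun y => ?_)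
  · simp only [id]; ring
  · simp only [Pi.mul_apply, id]; ring

lemma continuous_gaussWeight (κ : ℝ) : Continuous (gaussWeight κ) := by
  unfold gaussWeight; fun_prop

/-- Fourier coefficients of the Gaussian weight on `[-1, 1]` decay quadratically. -/
lemma norm_fourierCoeffOn_gaussWeight_le {κ : ℝ} (hκ : 0 ≤ κ) {j : ℤ} (hj : j ≠ 0) :
    ‖fourierCoeffOn (show (-1 : ℝ) < 1 by norm_num) (fun x => (gaussWeight κ x : ℂ)) j‖
      ≤ 16 * (κ + κ ^ 2) / j ^ 2 := by
  have hab : (-1 : ℝ) < 1 := by norm_num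
  have hj' : (0 : ℝ) < |(j : ℝ)| := by positivity
  have hcont := continuous_gaussWeight κ
  have e1 := fourierCoeffOn_of_hasDerivAt hab hj
    (fun x _ => (hasDerivAt_gaussWeight κ x).ofReal_comp) (by
      apply Continuous.intervalIntegrable
      fun_prop)
  have e2 := fourierCoeffOn_of_hasDerivAt hab hj
    (fun x _ => (hasDerivAt_deriv_gaussWeight κ x).ofReal_comp) (by
      apply Continuous.intervalIntegrable
      fun_prop)
  have b2 : ‖fourierCoeffOn hab
      (fun x => (((16 * π ^ 2 * κ ^ 2 * x ^ 2 - 4 * π * κ) * gaussWeight κ x : ℝ) : ℂ)) j‖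
      ≤ 16 * π ^ 2 * κ ^ 2 + 4 * π * κ := by
    refine norm_fourierCoeffOn_le (fun x hx => ?_) j
    rw [Complex.norm_real, Real.norm_eq_abs, abs_mul, abs_of_pos (gaussWeight_pos κ x)]
    have hx2 : x ^ 2 ≤ 1 := by nlinarith [hx.1, hx.2]
    have h1 : |16 * π ^ 2 * κ ^ 2 * x ^ 2 - 4 * π * κ| ≤ 16 * π ^ 2 * κ ^ 2 + 4 * π * κ := by
      have h3 : 0 ≤ 16 * π ^ 2 * κ ^ 2 := by positivity
      have h4 : 0 ≤ 4 * π * κ := by positivity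
      rw [abs_le]
      constructor <;> nlinarith [sq_nonneg x]
    calc _ ≤ (16 * π ^ 2 * κ ^ 2 + 4 * π * κ) * 1 := by
          exact mul_le_mul h1 (gaussWeight_le_one hκ x) (gaussWeight_pos κ x).le (by positivity)
      _ = _ := mul_one _
  have n1 : ‖(1 / (-2 * π * Complex.I * j) : ℂ)‖ = 1 / (2 * π * |(j : ℝ)|) := by
    simp [abs_of_pos Real.pi_pos]
  have b1 : ‖fourierCoeffOn hab (fun x => ((-(4 * π * κ * x) * gaussWeight κ x : ℝ) : ℂ)) j‖
      ≤ 1 / (2 * π * |(j : ℝ)|) * (16 * π * κ + 32 * π ^ 2 * κ ^ 2) := by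
    rw [e2, norm_mul, n1]
    gcongr
    refine (norm_sub_le _ _).trans ?_
    rw [norm_mul, norm_mul, fourier_apply, Circle.norm_coe, one_mul]
    have h1 : ‖(((-(4 * π * κ * 1) * gaussWeight κ 1 : ℝ) : ℂ)
        - ((-(4 * π * κ * -1) * gaussWeight κ (-1) : ℝ) : ℂ))‖ ≤ 8 * π * κ := by
      rw [← Complex.ofReal_sub, Complex.norm_real, Real.norm_eq_abs, gaussWeight_neg]
      have h5 := gaussWeight_le_one hκ 1
      have h6 := gaussWeight_pos κ 1
      have h4 : 0 ≤ 4 * π * κ := by positivity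
      rw [abs_le]
      constructor <;> nlinarith
    have h2 : ‖(((1 : ℝ) : ℂ) - ((-1 : ℝ) : ℂ))‖ = 2 := by norm_num
    rw [h2]
    linarith
  -- Evenness kills the boundary term of the first integration by parts; this is what yields `1/j²`
  -- instead of `1/j`.
  have h0 : gaussWeight κ 1 - gaussWeight κ (-1) = 0 := by rw [gaussWeight_neg, sub_self]
  rw [e1, norm_mul, n1, ← Complex.ofReal_sub, h0, Complex.ofReal_zero, mul_zero, zero_sub, norm_neg,
    norm_mul]
  have h2 : ‖(((1 : ℝ) : ℂ) - ((-1 : ℝ) : ℂ))‖ = 2 := by norm_num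
  rw [h2]
  calc _ ≤ 1 / (2 * π * |(j : ℝ)|) * (2 * (1 / (2 * π * |(j : ℝ)|) *
        (16 * π * κ + 32 * π ^ 2 * κ ^ 2))) := by gcongr
    _ = (8 * κ / π + 16 * κ ^ 2) / j ^ 2 := by
        rw [← sq_abs (j : ℝ)]
        field_simp
        ring
    _ ≤ _ := by
        gcongr
        have : 8 * κ / π ≤ 16 * κ := by
          rw [div_le_iff₀ Real.pi_pos]
          nlinarith [Real.pi_gt_three]
        linarith

/-- The Fourier coefficients of the Gaussian weight on `[-1, 1]`. -/
noncomputable def gaussCoeff (κ : ℝ) (j : ℤ) : ℂ :=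
  fourierCoeffOn (show (-1 : ℝ) < 1 by norm_num) (fun x => (gaussWeight κ x : ℂ)) j

lemma summable_gaussCoeff {κ : ℝ} (hκ : 0 ≤ κ) : Summable (gaussCoeff κ) := by
  have h : Summable fun j : ℤ => 16 * (κ + κ ^ 2) / (j : ℝ) ^ 2 := by
    simp_rw [div_eq_mul_inv]
    refine Summable.mul_left _ ?_
    simpa using Real.summable_one_div_int_pow.2 one_lt_two
  refine Summable.of_norm_bounded_eventually h ?_
  refine (Set.finite_singleton (0 : ℤ)).subset fun j hj => ?_
  by_contra h0
  exact hj (norm_fourierCoeffOn_gaussWeight_le hκ h0)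

/-- The even weight has a continuous 2-periodic extension, and its coefficients are summable, so the
series converges pointwise, endpoints included. -/
lemma hasSum_gaussCoeff {κ : ℝ} (hκ : 0 ≤ κ) {u : ℝ} (hu : u ∈ Set.Icc (-1 : ℝ) 1) :
    HasSum (fun j : ℤ => gaussCoeff κ j * expTwoPi (j * u / 2)) (gaussWeight κ u) := by
  have : Fact ((0 : ℝ) < 2) := ⟨two_pos⟩
  have hends : (gaussWeight κ (-1) : ℂ) = gaussWeight κ (-1 + 2) := by
    rw [gaussWeight_neg]; norm_num
  have hcont : Continuous (AddCircle.liftIco 2 (-1) fun x : ℝ => (gaussWeight κ x : ℂ)) := by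
    refine AddCircle.liftIco_continuous hends ?_
    exact (Complex.continuous_ofReal.comp (continuous_gaussWeight κ)).continuousOn
  set f : C(AddCircle (2 : ℝ), ℂ) := ⟨_, hcont⟩ with hf
  have hcoef : ∀ j, fourierCoeff f j = gaussCoeff κ j := by
    intro j
    have := fourierCoeff_liftIco_eq (T := 2) (a := -1) (fun x : ℝ => (gaussWeight κ x : ℂ)) j
    simp only [hf, ContinuousMap.coe_mk, gaussCoeff]
    rw [this]
    congr 1
    norm_num
  have hsum : Summable (fourierCoeff f) := by
    rw [funext hcoef]
    exact summable_gaussCoeff hκ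
  have key : ∀ u ∈ Set.Ico (-1 : ℝ) 1,
      HasSum (fun j : ℤ => gaussCoeff κ j * expTwoPi (j * u / 2)) (gaussWeight κ u) := by
    intro u hu
    have h := has_pointwise_sum_fourier_series_of_summable hsum (u : AddCircle (2 : ℝ))
    have hfu : f (u : AddCircle (2 : ℝ)) = gaussWeight κ u := by
      simp only [hf, ContinuousMap.coe_mk]
      rw [AddCircle.liftIco_coe_apply]
      exact ⟨hu.1, by linarith [hu.2]⟩
    rw [hfu] at h
    convert h using 2 with j
    rw [hcoef, fourier_coe_apply, smul_eq_mul, expTwoPi]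
    congr 2
    push_cast
    ring
  rcases hu.2.lt_or_eq with h | rfl
  · exact key u ⟨hu.1, h⟩
  · have h := key (-1) ⟨le_rfl, by norm_num⟩
    rw [gaussWeight_neg] at h
    convert h using 2 with j
    congr 1
    refine (expTwoPi_add_int _ (-j)).symm.trans (congrArg expTwoPi ?_)
    push_cast
    ring

/-- Interpolates between the bounds `2` and `2πx`. Any exponent in `(0, 1/2)` would serve: with `x`
of order `j²/(nq)`, the sum over `j` against coefficients of size `j⁻²` must converge, and a power
of `nq` must be saved. -/
lemma norm_expTwoPi_sub_one_le {x : ℝ} (hx : 0 ≤ x) :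
    ‖expTwoPi x - 1‖ ≤ 2 * (π * x) ^ (1 / 4 : ℝ) := by
  have h0 : 0 ≤ π * x := by positivity
  rcases le_total 1 (π * x) with h | h
  · calc _ ≤ ‖expTwoPi x‖ + ‖(1 : ℂ)‖ := norm_sub_le _ _
      _ = 2 * 1 := by rw [norm_expTwoPi, norm_one]; norm_num
      _ ≤ _ := by gcongr; exact Real.one_le_rpow h (by norm_num)
  · have h1 : ‖expTwoPi x - 1‖ ≤ 2 * (π * x) := by
      have := Real.norm_exp_I_mul_ofReal_sub_one_le (x := 2 * π * x)
      have e : Complex.exp (Complex.I * (2 * π * x : ℝ)) = expTwoPi x := by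
        rw [expTwoPi]; push_cast; ring_nf
      rw [e, Real.norm_eq_abs, abs_of_nonneg (by positivity)] at this
      linarith
    refine h1.trans ?_
    gcongr
    calc π * x = (π * x) ^ (1 : ℝ) := (Real.rpow_one _).symm
      _ ≤ _ := Real.rpow_le_rpow_of_exponent_ge' h0 h (by norm_num) (by norm_num)

/-! ### Reciprocity for weighted Gauss sums. -/

/-- The weighted quadratic Gauss sum. -/
noncomputable def weightedGaussSum (κ : ℝ) (n q : ℕ) : ℂ :=
  ∑ m ∈ Finset.Ico (-(q : ℤ)) q, gaussWeight κ (m / q) * expTwoPi (-(n * m ^ 2 / q))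

/-- The sum dual to `weightedGaussSum`. -/
noncomputable def dualGaussSum (κ : ℝ) (n q : ℕ) : ℂ :=
  ∑ s ∈ Finset.Ico (-(2 * n : ℤ)) (2 * n), gaussWeight κ (s / (2 * n)) *
    expTwoPi (q * s ^ 2 / (4 * n))

/-- Expand the weight into characters and apply reciprocity to each. The result would be exactly the
dual sum but for a phase `e(j²/(16nq))`. Replacing it by 1 costs `(j²/nq)^{1/4}`, against a trivial
bound of order `√(nq)` and coefficients of order `j⁻²`. -/
theorem weightedGaussSum_approx : ∃ C : ℝ, 0 < C ∧ ∀ (κ : ℝ), 0 ≤ κ → ∀ n q : ℕ, 0 < n → 0 < q →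
    ‖weightedGaussSum κ n q - √(q / (2 * n)) * expTwoPi (-1 / 8) * dualGaussSum κ n q‖
      ≤ C * (κ + κ ^ 2) * (n * q : ℝ) ^ (1 / 4 : ℝ) := by
  have hS : Summable fun j : ℤ => |(j : ℝ)| ^ (-(3 / 2) : ℝ) :=
    Real.summable_abs_int_rpow (by norm_num)
  set S := ∑' j : ℤ, |(j : ℝ)| ^ (-(3 / 2) : ℝ) with hSdef
  have hS0 : 0 ≤ S := tsum_nonneg fun j => by positivity
  refine ⟨128 * S + 1, by positivity, fun κ hκ n q hn hq => ?_⟩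
  have hn' : (0 : ℝ) < n := by exact_mod_cast hn
  have hq' : (0 : ℝ) < q := by exact_mod_cast hq
  have h1 : HasSum (fun j : ℤ => gaussCoeff κ j *
      ∑ m ∈ Finset.Ico (-(q : ℤ)) q, expTwoPi (-(n * m ^ 2 / q) + j * m / (2 * q)))
      (weightedGaussSum κ n q) := by
    have : HasSum (fun j : ℤ => ∑ m ∈ Finset.Ico (-(q : ℤ)) q,
        (gaussCoeff κ j * expTwoPi (j * (m / q) / 2)) * expTwoPi (-(n * m ^ 2 / q)))
        (weightedGaussSum κ n q) := by
      refine hasSum_sum fun m hm => ?_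
      refine (hasSum_gaussCoeff hκ ?_).mul_right _
      rw [Finset.mem_Ico] at hm
      have a1 : (-(q : ℝ)) ≤ m := by exact_mod_cast hm.1
      have a2 : (m : ℝ) ≤ q := by exact_mod_cast hm.2.le
      constructor
      · rw [le_div_iff₀ hq']; linarith
      · rw [div_le_iff₀ hq']; linarith
    convert this using 2 with j
    rw [Finset.mul_sum]
    refine Finset.sum_congr rfl fun m _ => ?_
    rw [mul_assoc, ← expTwoPi_add]
    congr 2
    field_simp
    ring
  have h2 : HasSum (fun j : ℤ => gaussCoeff κ j *
      ∑ s ∈ Finset.Ico (-(2 * n : ℤ)) (2 * n), expTwoPi (q * s ^ 2 / (4 * n) - j * s / (4 * n)))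
      (dualGaussSum κ n q) := by
    have : HasSum (fun j : ℤ => ∑ s ∈ Finset.Ico (-(2 * n : ℤ)) (2 * n),
        (gaussCoeff κ j * expTwoPi (j * (-(s / (2 * n))) / 2)) * expTwoPi (q * s ^ 2 / (4 * n)))
        (dualGaussSum κ n q) := by
      refine hasSum_sum fun s hs => ?_
      -- Evenness again: expanding at `-s/(2n)` gives the sign of `js/(4n)` that comes from
      -- completing the square.
      rw [← gaussWeight_neg]
      refine (hasSum_gaussCoeff hκ ?_).mul_right _
      rw [Finset.mem_Ico] at hs
      have a1 : (-(2 * n : ℝ)) ≤ s := by exact_mod_cast hs.1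
      have a2 : (s : ℝ) ≤ 2 * n := by exact_mod_cast hs.2.le
      constructor
      · rw [neg_le_neg_iff, div_le_iff₀ (by positivity)]; linarith
      · rw [neg_le, le_div_iff₀ (by positivity)]; linarith
    convert this using 2 with j
    rw [Finset.mul_sum]
    refine Finset.sum_congr rfl fun m _ => ?_
    rw [mul_assoc, ← expTwoPi_add]
    congr 2
    field_simp
    ring
  have h3 := h1.sub (h2.mul_left (√(q / (2 * n)) * expTwoPi (-1 / 8)))
  have hbd : ∀ j : ℤ, ‖gaussCoeff κ j *
      ∑ m ∈ Finset.Ico (-(q : ℤ)) q, expTwoPi (-(n * m ^ 2 / q) + j * m / (2 * q))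
      - (√(q / (2 * n)) * expTwoPi (-1 / 8)) * (gaussCoeff κ j *
      ∑ s ∈ Finset.Ico (-(2 * n : ℤ)) (2 * n), expTwoPi (q * s ^ 2 / (4 * n) - j * s / (4 * n)))‖
      ≤ 128 * (κ + κ ^ 2) * (n * q : ℝ) ^ (1 / 4 : ℝ) * |(j : ℝ)| ^ (-(3 / 2) : ℝ) := by
    intro j
    rw [quadratic_reciprocity_sum hn hq]
    have e : ∑ s ∈ Finset.Ico (-(2 * n : ℤ)) (2 * n), expTwoPi (q * (s - j / (2 * q)) ^ 2 / (4 * n))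
        = expTwoPi (j ^ 2 / (16 * n * q)) * ∑ s ∈ Finset.Ico (-(2 * n : ℤ)) (2 * n),
          expTwoPi (q * s ^ 2 / (4 * n) - j * s / (4 * n)) := by
      rw [Finset.mul_sum]
      refine Finset.sum_congr rfl fun s _ => ?_
      rw [← expTwoPi_add]
      congr 1
      field_simp
      ring
    rw [e]
    have hT : ‖∑ s ∈ Finset.Ico (-(2 * n : ℤ)) (2 * n),
        expTwoPi (q * s ^ 2 / (4 * n) - j * s / (4 * n))‖ ≤ 4 * n := by
      refine (norm_sum_le _ _).trans ?_
      simp only [norm_expTwoPi, Finset.sum_const, Int.card_Ico, nsmul_eq_mul, mul_one]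
      have : ((2 * n - -(2 * n : ℤ)).toNat) = 4 * n := by omega
      rw [this]
      push_cast
      exact le_rfl
    generalize (∑ s ∈ Finset.Ico (-(2 * n : ℤ)) (2 * n),
        expTwoPi (q * s ^ 2 / (4 * n) - j * s / (4 * n))) = T at hT
    have e2 : gaussCoeff κ j * (√(q / (2 * n)) * expTwoPi (-1 / 8) *
        (expTwoPi (j ^ 2 / (16 * n * q)) * T)) -
        √(q / (2 * n)) * expTwoPi (-1 / 8) * (gaussCoeff κ j * T)
        = gaussCoeff κ j * (√(q / (2 * n)) * (expTwoPi (-1 / 8) *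
          ((expTwoPi (j ^ 2 / (16 * n * q)) - 1) * T))) := by ring
    rw [e2, norm_mul, norm_mul, norm_mul, norm_mul, norm_expTwoPi, one_mul, Complex.norm_real,
      Real.norm_of_nonneg (Real.sqrt_nonneg _)]
    rcases eq_or_ne j 0 with rfl | hj
    · simp only [Int.cast_zero, zero_pow two_ne_zero, zero_div, expTwoPi_zero, sub_self, norm_zero,
        zero_mul, mul_zero]
      positivity
    have hj' : (0 : ℝ) < |(j : ℝ)| := by positivity
    have hx := norm_expTwoPi_sub_one_le (x := (j : ℝ) ^ 2 / (16 * n * q)) (by positivity)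
    have hnq : (0 : ℝ) < n * q := by positivity
    have hx2 : (π * ((j : ℝ) ^ 2 / (16 * n * q))) ^ (1 / 4 : ℝ)
        ≤ |(j : ℝ)| ^ (1 / 2 : ℝ) * (n * q : ℝ) ^ (-(1 / 4) : ℝ) := by
      have : (π * ((j : ℝ) ^ 2 / (16 * n * q))) ≤ |(j : ℝ)| ^ (2 : ℝ) * (n * q : ℝ) ^ (-1 : ℝ) := by
        rw [Real.rpow_neg_one, Real.rpow_two, sq_abs, ← div_eq_mul_inv, mul_div,
          div_le_div_iff₀ (by positivity) hnq]
        have : 0 ≤ (j : ℝ) ^ 2 * (n * q) := by positivity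
        nlinarith [Real.pi_lt_four]
      calc _ ≤ (|(j : ℝ)| ^ (2 : ℝ) * (n * q : ℝ) ^ (-1 : ℝ)) ^ (1 / 4 : ℝ) := by gcongr
        _ = _ := by
          rw [Real.mul_rpow (by positivity) (by positivity), ← Real.rpow_mul hj'.le,
            ← Real.rpow_mul hnq.le]
          norm_num
    have hsq : √(q / (2 * n)) * (4 * n) ≤ 4 * (n * q : ℝ) ^ (1 / 2 : ℝ) := by
      rw [← Real.sqrt_eq_rpow]
      have : √((q : ℝ) / (2 * n)) * n ≤ √(n * q) := by
        apply Real.le_sqrt_of_sq_le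
        rw [mul_pow, Real.sq_sqrt (by positivity)]
        have : (q : ℝ) / (2 * n) * n ^ 2 = q * n / 2 := by field_simp
        rw [this]
        nlinarith
      linarith
    calc _ ≤ 16 * (κ + κ ^ 2) / j ^ 2 * (√(q / (2 * n)) *
          ((2 * (|(j : ℝ)| ^ (1 / 2 : ℝ) * (n * q : ℝ) ^ (-(1 / 4) : ℝ))) * (4 * n))) := by
          gcongr
          · exact norm_fourierCoeffOn_gaussWeight_le hκ hj
          · exact hx.trans (by gcongr)
      _ = 32 * (κ + κ ^ 2) * (|(j : ℝ)| ^ (1 / 2 : ℝ) / j ^ 2) * ((√(q / (2 * n)) * (4 * n)) *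
          (n * q : ℝ) ^ (-(1 / 4) : ℝ)) := by ring
      _ ≤ 32 * (κ + κ ^ 2) * (|(j : ℝ)| ^ (1 / 2 : ℝ) / j ^ 2) * ((4 * (n * q : ℝ) ^ (1 / 2 : ℝ)) *
          (n * q : ℝ) ^ (-(1 / 4) : ℝ)) := by gcongr
      _ = _ := by
          have i1 : |(j : ℝ)| ^ (1 / 2 : ℝ) / j ^ 2 = |(j : ℝ)| ^ (-(3 / 2) : ℝ) := by
            rw [← sq_abs, ← Real.rpow_two, ← Real.rpow_sub hj']
            norm_num
          have i2 : (n * q : ℝ) ^ (1 / 2 : ℝ) * (n * q : ℝ) ^ (-(1 / 4) : ℝ)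
              = (n * q : ℝ) ^ (1 / 4 : ℝ) := by
            rw [← Real.rpow_add hnq]
            norm_num
          rw [i1, mul_assoc 4, i2]
          ring
  have hfin := tsum_of_norm_bounded (hS.hasSum.mul_left
    (128 * (κ + κ ^ 2) * (n * q : ℝ) ^ (1 / 4 : ℝ))) hbd
  rw [h3.tsum_eq] at hfin
  refine hfin.trans ?_
  rw [← hSdef]
  have : 0 ≤ (κ + κ ^ 2) * (n * q : ℝ) ^ (1 / 4 : ℝ) := by positivity
  nlinarith

/-! ### The sawtooth as a harmonic boundary value, and its Poisson integral. -/

/-- The sawtooth function `{x} - 1/2`. -/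
noncomputable def sawtooth (x : ℝ) : ℝ := Int.fract x - 1 / 2

lemma abs_sawtooth_le (x : ℝ) : |sawtooth x| ≤ 1 / 2 := by
  rw [sawtooth, abs_le]
  constructor <;> linarith [Int.fract_nonneg x, Int.fract_lt_one x]

lemma measurable_sawtooth : Measurable sawtooth := measurable_fract.sub_const _

/-- The holomorphic function `1 - e(w)`. -/
noncomputable def oneSubExp (w : ℂ) : ℂ := 1 - Complex.exp (2 * π * Complex.I * w)

lemma differentiable_oneSubExp : Differentiable ℂ oneSubExp := by
  unfold oneSubExp; fun_prop

lemma norm_exp_two_pi_I (w : ℂ) : ‖Complex.exp (2 * π * Complex.I * w)‖ = Real.exp (-2 * π * w.im) := by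
  rw [Complex.norm_exp]
  congr 1
  simp

lemma re_oneSubExp_pos {w : ℂ} (hw : 0 < w.im) : 0 < (oneSubExp w).re := by
  have h1 : ‖Complex.exp (2 * π * Complex.I * w)‖ < 1 := by
    rw [norm_exp_two_pi_I, Real.exp_lt_one_iff]
    have : 0 < 2 * π * w.im := by positivity
    linarith
  have h2 := Complex.re_le_norm (Complex.exp (2 * π * Complex.I * w))
  rw [oneSubExp, Complex.sub_re, Complex.one_re]
  linarith

lemma oneSubExp_ofReal (x : ℝ) : oneSubExp x = 1 - expTwoPi x := by
  rw [oneSubExp, expTwoPi]; ring_nf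

lemma oneSubExp_eq_polar (t : ℝ) : 1 - expTwoPi t =
    ((2 * Real.sin (π * t) : ℝ) : ℂ) *
      (Complex.cos ((π * (t - 1 / 2) : ℝ) : ℂ) + Complex.sin ((π * (t - 1 / 2) : ℝ) : ℂ) * Complex.I) := by
  have h1 : (2 * π * t * Complex.I : ℂ) = ((2 * (π * t) : ℝ) : ℂ) * Complex.I := by push_cast; ring
  have h2 : π * (t - 1 / 2) = π * t - π / 2 := by ring
  rw [expTwoPi, h1, Complex.exp_mul_I, h2, ← Complex.ofReal_cos, ← Complex.ofReal_sin,
    ← Complex.ofReal_cos, ← Complex.ofReal_sin, Real.cos_sub_pi_div_two, Real.sin_sub_pi_div_two,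
    Real.cos_two_mul, Real.sin_two_mul]
  have hsc : (Real.sin (π * t) : ℂ) ^ 2 + (Real.cos (π * t) : ℂ) ^ 2 = 1 := by
    exact_mod_cast Real.sin_sq_add_cos_sq (π * t)
  generalize Real.sin (π * t) = s at *
  generalize Real.cos (π * t) = c at *
  push_cast
  linear_combination (-2 : ℂ) * hsc

/-- From `1 - e(t) = 2 sin(πt) exp(iπ(t - 1/2))` for `0 < t < 1`. Integers are excluded because `1 -
e(x)` vanishes there. -/
lemma arg_oneSubExp_ofReal {x : ℝ} (hx : Int.fract x ≠ 0) :
    (oneSubExp x).re > 0 ∧ Complex.arg (oneSubExp x) = π * sawtooth x := by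
  have h0 : 0 < Int.fract x := lt_of_le_of_ne (Int.fract_nonneg x) (Ne.symm hx)
  have h1 := Int.fract_lt_one x
  have hs : 0 < 2 * Real.sin (π * Int.fract x) := by
    have := Real.sin_pos_of_pos_of_lt_pi (x := π * Int.fract x) (by positivity)
      (by nlinarith [Real.pi_pos])
    linarith
  have he : oneSubExp x = 1 - expTwoPi (Int.fract x) := by
    rw [oneSubExp_ofReal, ← expTwoPi_add_int (Int.fract x) ⌊x⌋, Int.fract_add_floor]
  have hπ := Real.pi_pos
  rw [he, oneSubExp_eq_polar]
  constructor
  · rw [← Complex.ofReal_cos, ← Complex.ofReal_sin]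
    simp only [Complex.mul_re, Complex.add_re, Complex.ofReal_re, Complex.I_re, mul_zero,
      Complex.ofReal_im, Complex.I_im, mul_one, sub_self, add_zero, zero_mul, sub_zero]
    have := Real.cos_pos_of_mem_Ioo (x := π * (Int.fract x - 1 / 2)) ⟨by nlinarith, by nlinarith⟩
    positivity
  · rw [Complex.arg_mul_cos_add_sin_mul_I hs ⟨by nlinarith, by nlinarith⟩, sawtooth]

/-- The Cayley transform of the unit disc onto the upper half-plane, with `0 ↦ x + iy`. -/
noncomputable def cayley (x y : ℝ) (ζ : ℂ) : ℂ := x + y * Complex.I * ((1 - ζ) / (1 + ζ))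

lemma cayley_im_pos (x : ℝ) {y : ℝ} (hy : 0 < y) {ζ : ℂ} (hζ : ‖ζ‖ < 1) :
    0 < (cayley x y ζ).im := by
  have hne : 1 + ζ ≠ 0 := by
    intro h
    have : ζ = -1 := by linear_combination h
    rw [this] at hζ
    simp at hζ
  have h1 : (cayley x y ζ).im = y * ((1 - ζ) / (1 + ζ)).re := by
    simp [cayley]
  have h2 : ((1 - ζ) / (1 + ζ)).re = (1 - ‖ζ‖ ^ 2) / Complex.normSq (1 + ζ) := by
    rw [Complex.div_re, ← Complex.normSq_eq_norm_sq, Complex.normSq_apply ζ, ← add_div]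
    congr 1
    simp
    ring
  rw [h1, h2]
  have : 0 < Complex.normSq (1 + ζ) := Complex.normSq_pos.2 hne
  have h3 : 0 < 1 - ‖ζ‖ ^ 2 := by nlinarith [norm_nonneg ζ]
  positivity

lemma cayley_circle (x y : ℝ) {θ : ℝ} (hθ : θ ∈ Set.Ioo (-π) π) :
    1 + circleMap 0 1 θ ≠ 0 ∧ cayley x y (circleMap 0 1 θ) = ((x + y * Real.tan (θ / 2) : ℝ) : ℂ) := by
  have hc : 0 < Real.cos (θ / 2) := Real.cos_pos_of_mem_Ioo ⟨by linarith [hθ.1], by linarith [hθ.2]⟩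
  have hcC : (Real.cos (θ / 2) : ℂ) ≠ 0 := by exact_mod_cast hc.ne'
  set E := Complex.exp ((θ / 2 : ℝ) * Complex.I) with hE
  have hE0 : E ≠ 0 := Complex.exp_ne_zero _
  have e1 : circleMap 0 1 θ = E * E := by
    rw [circleMap_zero, hE, ← Complex.exp_add]
    push_cast
    ring_nf
  have e2 : E = Real.cos (θ / 2) + Real.sin (θ / 2) * Complex.I := by
    rw [hE, Complex.exp_mul_I, Complex.ofReal_cos, Complex.ofReal_sin]
  have hsc : (Real.cos (θ / 2) : ℂ) ^ 2 + (Real.sin (θ / 2) : ℂ) ^ 2 = 1 := by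
    exact_mod_cast Real.cos_sq_add_sin_sq (θ / 2)
  have e3 : 1 + E * E = 2 * Real.cos (θ / 2) * E := by
    rw [e2]; linear_combination (-1 : ℂ) * hsc + (Real.sin (θ / 2) : ℂ) ^ 2 * Complex.I_sq
  have e4 : 1 - E * E = -2 * Complex.I * Real.sin (θ / 2) * E := by
    rw [e2]; linear_combination (-1 : ℂ) * hsc + (Real.sin (θ / 2) : ℂ) ^ 2 * Complex.I_sq
  refine ⟨?_, ?_⟩
  · rw [e1, e3]
    exact mul_ne_zero (mul_ne_zero two_ne_zero hcC) hE0
  · rw [cayley, e1, e3, e4, Real.tan_eq_sin_div_cos]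
    push_cast at hcC ⊢
    field_simp
    linear_combination (-(y : ℂ) * Complex.sin (θ / 2)) * Complex.I_sq

lemma sub_div_im_pos {a : ℝ} (ha : 0 ≤ a) {z : ℂ} (hz : 0 < z.im) : 0 < (z - a / z).im := by
  rw [Complex.sub_im, div_eq_mul_inv, Complex.im_ofReal_mul, Complex.inv_im]
  have : 0 < Complex.normSq z := Complex.normSq_pos.2 (by rintro rfl; simp at hz)
  have : 0 ≤ a * (z.im / Complex.normSq z) := by positivity
  have e : a * (-z.im / Complex.normSq z) = -(a * (z.im / Complex.normSq z)) := by ring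
  linarith

/-- The jumps of the sawtooth lie at roots of `R² - kR - a` with `k` an integer, at most two for
each `k`, and `tan` is injective on the range. The radial limit thus holds almost everywhere. -/
lemma countable_exceptional (a x : ℝ) {y : ℝ} (hy : 0 < y) :
    {θ ∈ Set.Ioo (-π) π | x + y * Real.tan (θ / 2) = 0 ∨
      Int.fract (x + y * Real.tan (θ / 2) - a / (x + y * Real.tan (θ / 2))) = 0}.Countable := by
  have hB : {R : ℝ | R = 0 ∨ ∃ k : ℤ, R ^ 2 - k * R - a = 0 ∧ R ≠ 0}.Countable := by
    have : {R : ℝ | R = 0 ∨ ∃ k : ℤ, R ^ 2 - k * R - a = 0 ∧ R ≠ 0}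
        ⊆ {0} ∪ ⋃ k : ℤ, {R : ℝ | R ^ 2 - k * R - a = 0} := by
      rintro R (h | ⟨k, hk, -⟩)
      · exact Or.inl h
      · exact Or.inr (Set.mem_iUnion.2 ⟨k, hk⟩)
    refine Set.Countable.mono this ((Set.countable_singleton 0).union (Set.countable_iUnion fun k => ?_))
    have hs : {R : ℝ | R ^ 2 - k * R - a = 0}
        ⊆ {((k + √(k ^ 2 + 4 * a)) / 2 : ℝ), ((k - √(k ^ 2 + 4 * a)) / 2 : ℝ)} := by
      intro R (hR : R ^ 2 - k * R - a = 0)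
      have hd : (k : ℝ) ^ 2 + 4 * a = (2 * R - k) ^ 2 := by linear_combination (-4 : ℝ) * hR
      rw [hd, Real.sqrt_sq_eq_abs]
      rcases abs_cases (2 * R - k) with ⟨h, -⟩ | ⟨h, -⟩
      · left; rw [h]; ring
      · right; rw [Set.mem_singleton_iff, h]; ring
    exact ((Set.finite_singleton _).insert _).countable.mono hs
  refine Set.MapsTo.countable_of_injOn (f := fun θ => x + y * Real.tan (θ / 2)) ?_ ?_ hB
  · rintro θ ⟨hθ, h | h⟩
    · exact Or.inl h
    · by_cases h0 : x + y * Real.tan (θ / 2) = 0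
      · exact Or.inl h0
      · right
        obtain ⟨k, hk⟩ := Int.fract_eq_zero_iff.1 h
        refine ⟨k, ?_, h0⟩
        simp only
        rw [hk]
        field_simp
        ring
  · rintro θ₁ ⟨h₁, -⟩ θ₂ ⟨h₂, -⟩ h
    simp only [add_right_inj, mul_eq_mul_left_iff, hy.ne', or_false] at h
    have := Real.injOn_tan ⟨by linarith [h₁.1], by linarith [h₁.2]⟩
      ⟨by linarith [h₂.1], by linarith [h₂.2]⟩ h
    linarith

/-- The Poisson integral of the sawtooth along `R ↦ R - a / R`. -/
theorem integral_sawtooth_cayley {a : ℝ} (ha : 0 ≤ a) (x : ℝ) {y : ℝ} (hy : 0 < y) :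
    ∫ θ in (-π)..π, sawtooth (x + y * Real.tan (θ / 2) - a / (x + y * Real.tan (θ / 2)))
      = 2 * (Complex.log (oneSubExp ((x + y * Complex.I) - a / (x + y * Complex.I)))).im := by
  set φ : ℂ → ℂ := fun ζ => cayley x y ζ - a / cayley x y ζ with hφ
  set G : ℂ → ℂ := fun ζ => Complex.log (oneSubExp (φ ζ)) with hG
  have hC0 : cayley x y 0 = x + y * Complex.I := by simp [cayley]
  have hCd : ∀ ζ : ℂ, 1 + ζ ≠ 0 → DifferentiableAt ℂ (cayley x y) ζ := by
    intro ζ hζ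
    unfold cayley
    fun_prop (disch := exact hζ)
  have hφd : ∀ ζ : ℂ, 1 + ζ ≠ 0 → cayley x y ζ ≠ 0 → DifferentiableAt ℂ φ ζ := by
    intro ζ h1 h2
    exact (hCd ζ h1).sub ((differentiableAt_const _).div (hCd ζ h1) h2)
  have hGd : ∀ ζ : ℂ, 1 + ζ ≠ 0 → cayley x y ζ ≠ 0 → 0 < (oneSubExp (φ ζ)).re →
      DifferentiableAt ℂ G ζ := by
    intro ζ h1 h2 h3
    exact ((differentiable_oneSubExp _).comp ζ (hφd ζ h1 h2)).clog (Or.inl h3)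
  have hin : ∀ ζ : ℂ, ‖ζ‖ < 1 → 1 + ζ ≠ 0 ∧ cayley x y ζ ≠ 0 ∧ 0 < (oneSubExp (φ ζ)).re := by
    intro ζ hζ
    have hi := cayley_im_pos x hy hζ
    refine ⟨?_, ?_, re_oneSubExp_pos (sub_div_im_pos ha hi)⟩
    · intro h
      have : ζ = -1 := by linear_combination h
      rw [this] at hζ
      simp at hζ
    · intro h; rw [h] at hi; simp at hi
  have hGin : ∀ ζ : ℂ, ‖ζ‖ < 1 → DifferentiableAt ℂ G ζ := fun ζ hζ =>
    hGd ζ (hin ζ hζ).1 (hin ζ hζ).2.1 (hin ζ hζ).2.2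
  have hcirc : ∀ r ∈ Set.Ioo (0 : ℝ) 1, ∀ θ, ‖circleMap 0 r θ‖ < 1 := by
    intro r hr θ
    rw [norm_circleMap_zero, abs_of_pos hr.1]
    exact hr.2
  -- The mean value property is used on circles of radius `r < 1`. As `r → 1` dominated convergence
  -- applies, because `1 - e(w)` has positive real part and so its argument stays within `π/2`.
  have hmean : ∀ r ∈ Set.Ioo (0 : ℝ) 1,
      ∫ θ in (-π)..π, (G (circleMap 0 r θ)).im = 2 * π * (G 0).im := by
    intro r hr
    have hdc : DiffContOnCl ℂ G (Metric.ball 0 |r|) := by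
      refine DifferentiableOn.diffContOnCl fun ζ hζ => (hGin ζ ?_).differentiableWithinAt
      have := Metric.closure_ball_subset_closedBall hζ
      rw [mem_closedBall_zero_iff, abs_of_pos hr.1] at this
      exact this.trans_lt hr.2
    have h1 := hdc.circleAverage
    rw [Real.circleAverage_eq_integral_add (-π),
      intervalIntegral.integral_comp_add_right (fun θ => G (circleMap 0 r θ))] at h1
    rw [show (0 + -π) = -π by ring, show (2 * π + -π) = π by ring] at h1
    have hcont : Continuous fun θ => G (circleMap 0 r θ) := by
      rw [continuous_iff_continuousAt]
      intro θ
      exact (hGin _ (hcirc r hr θ)).continuousAt.comp (continuous_circleMap 0 r).continuousAt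
    have h2 := Complex.imCLM.intervalIntegral_comp_comm (hcont.intervalIntegrable (μ := volume) (-π) π)
    simp only [Complex.imCLM_apply] at h2
    rw [h2, ← h1]
    simp only [Complex.real_smul, Complex.im_ofReal_mul]
    field_simp
  have hlim : Tendsto (fun r => ∫ θ in (-π)..π, (G (circleMap 0 r θ)).im) (𝓝[<] 1)
      (𝓝 (∫ θ in (-π)..π,
        π * sawtooth (x + y * Real.tan (θ / 2) - a / (x + y * Real.tan (θ / 2))))) := by
    have hev : ∀ᶠ r in 𝓝[<] (1 : ℝ), r ∈ Set.Ioo (0 : ℝ) 1 := Ioo_mem_nhdsLT one_pos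
    refine intervalIntegral.tendsto_integral_filter_of_dominated_convergence (fun _ => π / 2) ?_ ?_
      (intervalIntegrable_const) ?_
    · filter_upwards [hev] with r hr
      have hcont : Continuous fun θ => (G (circleMap 0 r θ)).im := by
        rw [continuous_iff_continuousAt]
        intro θ
        exact Complex.continuous_im.continuousAt.comp
          ((hGin _ (hcirc r hr θ)).continuousAt.comp (continuous_circleMap 0 r).continuousAt)
      exact hcont.aestronglyMeasurable
    · filter_upwards [hev] with r hr
      refine Eventually.of_forall fun θ _ => ?_
      rw [hG, Complex.log_im, Real.norm_eq_abs]
      exact Complex.abs_arg_le_pi_div_two_iff.2 (hin _ (hcirc r hr θ)).2.2.le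
    · have hbad := (countable_exceptional a x hy).ae_notMem volume
      have hpi : ∀ᵐ θ : ℝ, θ ≠ π := (Set.countable_singleton π).ae_notMem volume
      filter_upwards [hbad, hpi] with θ h1 h2 h3
      rw [Set.uIoc_of_le (by linarith [Real.pi_pos])] at h3
      have hθ : θ ∈ Set.Ioo (-π) π := ⟨h3.1, lt_of_le_of_ne h3.2 h2⟩
      have h4 : ¬ (x + y * Real.tan (θ / 2) = 0 ∨
        Int.fract (x + y * Real.tan (θ / 2) - a / (x + y * Real.tan (θ / 2))) = 0) :=
        fun h => h1 ⟨hθ, h⟩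
      push Not at h4
      obtain ⟨c1, c2⟩ := cayley_circle x y hθ
      have c3 : φ (circleMap 0 1 θ) =
          ((x + y * Real.tan (θ / 2) - a / (x + y * Real.tan (θ / 2)) : ℝ) : ℂ) := by
        simp only [hφ, c2]
        push_cast
        rfl
      obtain ⟨d1, d2⟩ := arg_oneSubExp_ofReal h4.2
      have hd : DifferentiableAt ℂ G (circleMap 0 1 θ) := by
        refine hGd _ c1 ?_ ?_
        · rw [c2]; exact_mod_cast h4.1
        · rw [c3]; exact d1
      have hval : (G (circleMap 0 1 θ)).im =
          π * sawtooth (x + y * Real.tan (θ / 2) - a / (x + y * Real.tan (θ / 2))) := by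
        rw [hG, Complex.log_im, c3, d2]
      rw [← hval]
      have hcm : Tendsto (fun r : ℝ => circleMap 0 r θ) (𝓝[<] 1) (𝓝 (circleMap 0 1 θ)) := by
        have : Continuous fun r : ℝ => circleMap 0 r θ := by unfold circleMap; fun_prop
        exact (this.tendsto 1).mono_left nhdsWithin_le_nhds
      exact (Complex.continuous_im.tendsto _).comp (hd.continuousAt.tendsto.comp hcm)
  have hconst : Tendsto (fun r => ∫ θ in (-π)..π, (G (circleMap 0 r θ)).im) (𝓝[<] 1)
      (𝓝 (2 * π * (G 0).im)) := by
    refine Tendsto.congr' ?_ tendsto_const_nhds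
    filter_upwards [Ioo_mem_nhdsLT (one_pos (α := ℝ))] with r hr
    exact (hmean r hr).symm
  have hfin := tendsto_nhds_unique hlim hconst
  rw [intervalIntegral.integral_const_mul] at hfin
  have hG0 : G 0 = Complex.log (oneSubExp ((x + y * Complex.I) - a / (x + y * Complex.I))) := by
    simp only [hG, hφ, hC0]
  rw [← hG0]
  have hπ := Real.pi_ne_zero
  have : π * (∫ θ in (-π)..π, sawtooth (x + y * Real.tan (θ / 2) - a / (x + y * Real.tan (θ / 2))))
      = π * (2 * (G 0).im) := by rw [hfin]; ring
  exact mul_left_cancel₀ hπ this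

/-- A large Poisson integral forces a large value of the sawtooth sum near the centre. -/
theorem exists_sum_sawtooth_gt (S : Finset ℤ) (x : ℝ) {y B M : ℝ} (hy : 0 < y) (hB : 0 < B)
    (hM : 0 ≤ M) (h : M + S.card * (y / B) < π⁻¹ * ∑ m ∈ S,
      (Complex.log (oneSubExp ((x + y * Complex.I) - (m ^ 2 : ℝ) / (x + y * Complex.I)))).im) :
    ∃ R : ℝ, |R - x| ≤ B ∧ M < ∑ m ∈ S, sawtooth (R - m ^ 2 / R) := by
  by_contra! hcon
  set F : ℝ → ℝ := fun θ => ∑ m ∈ S, sawtooth (x + y * Real.tan (θ / 2)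
    - (m ^ 2 : ℝ) / (x + y * Real.tan (θ / 2))) with hF
  have hmeas : ∀ m : ℤ, Measurable fun θ : ℝ => sawtooth (x + y * Real.tan (θ / 2)
    - (m ^ 2 : ℝ) / (x + y * Real.tan (θ / 2))) := by
    intro m
    refine measurable_sawtooth.comp ?_
    have : Measurable fun θ : ℝ => x + y * Real.tan (θ / 2) := by
      have h1 : Measurable fun θ : ℝ => Real.tan (θ / 2) := by
        simp_rw [Real.tan_eq_sin_div_cos]
        fun_prop
      exact (h1.const_mul y).const_add x
    exact this.sub (measurable_const.div this)
  have hint1 : ∀ (m : ℤ) (u v : ℝ), IntervalIntegrable (fun θ : ℝ => sawtooth (x + y * Real.tan (θ / 2)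
    - (m ^ 2 : ℝ) / (x + y * Real.tan (θ / 2)))) volume u v := by
    intro m u v
    refine (intervalIntegrable_const (c := (1 / 2 : ℝ))).mono_fun (hmeas m).aestronglyMeasurable ?_
    refine Eventually.of_forall fun θ => ?_
    simp only [Real.norm_eq_abs]
    rw [abs_of_pos (by norm_num : (0 : ℝ) < 1 / 2)]
    exact abs_sawtooth_le _
  have hint : ∀ u v : ℝ, IntervalIntegrable F volume u v := fun u v => by
    have := IntervalIntegrable.sum (μ := volume) (a := u) (b := v) S fun m _ => hint1 m u v
    have e : F = ∑ m ∈ S, fun θ : ℝ => sawtooth (x + y * Real.tan (θ / 2)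
        - (m ^ 2 : ℝ) / (x + y * Real.tan (θ / 2))) := by
      ext θ
      simp [hF]
    rw [e]
    exact this
  have htot : ∫ θ in (-π)..π, F θ = 2 * ∑ m ∈ S,
      (Complex.log (oneSubExp ((x + y * Complex.I) - (m ^ 2 : ℝ) / (x + y * Complex.I)))).im := by
    simp only [hF]
    rw [intervalIntegral.integral_finsetSum fun m _ => hint1 m _ _, Finset.mul_sum]
    exact Finset.sum_congr rfl fun m _ => integral_sawtooth_cayley (sq_nonneg _) x hy
  have hFb : ∀ θ, F θ ≤ S.card / 2 := by
    intro θ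
    calc F θ ≤ ∑ m ∈ S, (1 / 2 : ℝ) :=
          Finset.sum_le_sum fun m _ => (abs_le.1 (abs_sawtooth_le _)).2
      _ = _ := by simp; ring
  -- Under `R = x + y tan(θ/2)` the window `|R - x| ≤ B` is `|θ| ≤ t`. Outside it the sum is at most
  -- `S.card / 2`, and the excluded arcs have total length `2(π - t) ≤ 4y/B`.
  set t := 2 * Real.arctan (B / y) with ht
  have ht0 : 0 ≤ t := by
    have : 0 ≤ Real.arctan (B / y) := Real.arctan_nonneg.2 (by positivity)
    positivity
  have htπ : π - t ≤ 2 * (y / B) := by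
    have h1 := Real.arctan_inv_of_pos (x := B / y) (by positivity)
    rw [inv_div] at h1
    have h2 : Real.arctan (y / B) ≤ y / B := by
      have hp : 0 ≤ y / B := by positivity
      have := Real.le_tan (Real.arctan_nonneg.2 hp) (Real.arctan_lt_pi_div_two _)
      rwa [Real.tan_arctan] at this
    rw [ht]; linarith
  have htπ' : t ≤ π := by have := Real.arctan_lt_pi_div_two (B / y); rw [ht]; linarith
  have hmid : ∀ θ ∈ Set.Icc (-t) t, θ ∈ Set.Ioo (-π) π → F θ ≤ M := by
    intro θ hθ _
    refine hcon _ ?_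
    rw [add_sub_cancel_left, abs_mul, abs_of_pos hy]
    have hat := Real.arctan_lt_pi_div_two (B / y)
    have hat2 := Real.neg_pi_div_two_lt_arctan (B / y)
    have hb : |Real.tan (θ / 2)| ≤ B / y := by
      rw [abs_le]
      constructor
      · rw [← Real.tan_arctan (B / y), ← Real.tan_neg]
        rcases (show -Real.arctan (B / y) ≤ θ / 2 by linarith [hθ.1]).eq_or_lt with h | h
        · rw [h]
        · exact (Real.tan_lt_tan_of_lt_of_lt_pi_div_two (by linarith) (by linarith [hθ.2]) h).le
      · conv_rhs => rw [← Real.tan_arctan (B / y)]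
        rcases (show θ / 2 ≤ Real.arctan (B / y) by linarith [hθ.2]).eq_or_lt with h | h
        · rw [h]
        · exact (Real.tan_lt_tan_of_lt_of_lt_pi_div_two (by linarith [hθ.1]) (by linarith) h).le
    calc _ ≤ y * (B / y) := by gcongr
      _ = B := by field_simp
  have htlt : t < π := by have := Real.arctan_lt_pi_div_two (B / y); rw [ht]; linarith
  have s1 : ∫ θ in (-π)..(-t), F θ ≤ S.card / 2 * (π - t) := by
    have := intervalIntegral.integral_mono_on (by linarith : -π ≤ -t) (hint _ _)
      (intervalIntegrable_const (c := (S.card / 2 : ℝ))) fun θ _ => hFb θ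
    rw [intervalIntegral.integral_const, smul_eq_mul] at this
    linarith
  have s2 : ∫ θ in (-t)..t, F θ ≤ M * (2 * t) := by
    have := intervalIntegral.integral_mono_on (by linarith : -t ≤ t) (hint _ _)
      (intervalIntegrable_const (c := M)) fun θ hθ => hmid θ hθ ⟨by linarith [hθ.1], by linarith [hθ.2]⟩
    rw [intervalIntegral.integral_const, smul_eq_mul] at this
    linarith
  have s3 : ∫ θ in t..π, F θ ≤ S.card / 2 * (π - t) := by
    have := intervalIntegral.integral_mono_on htπ' (hint _ _)
      (intervalIntegrable_const (c := (S.card / 2 : ℝ))) fun θ _ => hFb θ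
    rw [intervalIntegral.integral_const, smul_eq_mul] at this
    linarith
  have s4 : ∫ θ in (-π)..π, F θ ≤ S.card * (π - t) + M * (2 * t) := by
    rw [← intervalIntegral.integral_add_adjacent_intervals (hint (-π) t) (hint t π),
      ← intervalIntegral.integral_add_adjacent_intervals (hint (-π) (-t)) (hint (-t) t)]
    linarith
  rw [htot] at s4
  set T := ∑ m ∈ S,
      (Complex.log (oneSubExp ((x + y * Complex.I) - (m ^ 2 : ℝ) / (x + y * Complex.I)))).im with hT
  have hπ := Real.pi_pos
  rw [inv_mul_eq_div, lt_div_iff₀ hπ] at h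
  have hc : (0 : ℝ) ≤ S.card := by positivity
  have hyB : 0 < y / B := by positivity
  have i1 : S.card * (π - t) ≤ S.card * (2 * (y / B)) := by gcongr
  have i2 : M * (2 * t) ≤ M * (2 * π) := by gcongr
  have i3 : S.card * (y / B) * 1 ≤ S.card * (y / B) * π := by
    gcongr
    linarith [Real.pi_gt_three]
  nlinarith

/-! ### Expansion of the Poisson mean at `q²/(q - iη)` into harmonics. -/

lemma summable_exp_neg_mul {η : ℝ} (hη : 0 < η) : Summable fun n : ℕ => Real.exp (-(n * η)) := by
  have := Real.summable_exp_nat_mul_iff.2 (neg_lt_zero.2 hη)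
  simpa using this

lemma tsum_exp_neg_mul_le {η : ℝ} (hη : 0 < η) (hη1 : η ≤ 1) :
    ∑' n : ℕ, Real.exp (-(n * η)) ≤ 2 / η := by
  have h1 : ∀ n : ℕ, Real.exp (-(n * η)) = Real.exp (-η) ^ n := by
    intro n; rw [← Real.exp_nat_mul]; ring_nf
  simp_rw [h1]
  have h2 : Real.exp (-η) < 1 := by rw [Real.exp_lt_one_iff]; linarith
  rw [tsum_geometric_of_lt_one (Real.exp_pos _).le h2, ← one_div, div_le_div_iff₀ (by linarith) hη]
  have h3 : (1 + η) * Real.exp (-η) ≤ 1 := by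
    rw [Real.exp_neg, mul_inv_le_iff₀ (Real.exp_pos _)]
    linarith [Real.add_one_le_exp η]
  nlinarith [Real.exp_pos (-η)]

lemma norm_exp_sub_exp_le {a b : ℂ} {c : ℝ} (ha : a.re ≤ c) (hb : b.re ≤ c) :
    ‖Complex.exp a - Complex.exp b‖ ≤ Real.exp c * ‖a - b‖ := by
  have hconv : Convex ℝ {z : ℂ | z.re ≤ c} := convex_halfSpace_re_le c
  refine hconv.norm_image_sub_le_of_norm_hasDerivWithin_le (f := Complex.exp) (f' := Complex.exp)
    (fun z _ => (Complex.hasDerivAt_exp z).hasDerivWithinAt) (fun z hz => ?_) hb ha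
  rw [Complex.norm_exp]
  exact Real.exp_le_exp.2 hz

lemma norm_weightedGaussSum_le {κ : ℝ} (hκ : 0 ≤ κ) (n q : ℕ) :
    ‖weightedGaussSum κ n q‖ ≤ 2 * q := by
  rw [weightedGaussSum]
  refine (norm_sum_le_of_le (f := fun m : ℤ => (gaussWeight κ (m / q) : ℂ) *
    expTwoPi (-(n * m ^ 2 / q))) _ (fun m _ => (?_ : _ ≤ (1 : ℝ)))).trans ?_
  · rw [norm_mul, norm_expTwoPi, mul_one, Complex.norm_real,
      Real.norm_of_nonneg (gaussWeight_pos _ _).le]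
    exact gaussWeight_le_one hκ _
  · simp only [Finset.sum_const, Int.card_Ico, nsmul_eq_mul, mul_one]
    have : ((q : ℤ) - -q).toNat = 2 * q := by omega
    rw [this]
    push_cast
    exact le_rfl

lemma norm_dualGaussSum_le {κ : ℝ} (hκ : 0 ≤ κ) (n q : ℕ) :
    ‖dualGaussSum κ n q‖ ≤ 4 * n := by
  rw [dualGaussSum]
  refine (norm_sum_le_of_le (f := fun s : ℤ => (gaussWeight κ (s / (2 * n)) : ℂ) *
    expTwoPi (q * s ^ 2 / (4 * n))) _ (fun m _ => (?_ : _ ≤ (1 : ℝ)))).trans ?_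
  · rw [norm_mul, norm_expTwoPi, mul_one, Complex.norm_real,
      Real.norm_of_nonneg (gaussWeight_pos _ _).le]
    exact gaussWeight_le_one hκ _
  · simp only [Finset.sum_const, Int.card_Ico, nsmul_eq_mul, mul_one]
    have : ((2 * n : ℤ) - -(2 * n)).toNat = 4 * n := by omega
    rw [this]
    push_cast
    exact le_rfl

/-- The real part of the point `q² / (q - iη)`. -/
noncomputable def centreRe (η : ℝ) (q : ℕ) : ℝ := q ^ 3 / (q ^ 2 + η ^ 2)

/-- The imaginary part of the point `q² / (q - iη)`. -/
noncomputable def centreIm (η : ℝ) (q : ℕ) : ℝ := η * q ^ 2 / (q ^ 2 + η ^ 2)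

/-- The Poisson mean of the sum of the sawtooth around `q`. -/
noncomputable def poissonMean (η : ℝ) (q : ℕ) : ℝ :=
  π⁻¹ * ∑ m ∈ Finset.Ico (-(q : ℤ)) q,
    (Complex.log (oneSubExp ((centreRe η q + centreIm η q * Complex.I)
      - (m ^ 2 : ℝ) / (centreRe η q + centreIm η q * Complex.I)))).im

/-- The centre is chosen so that `1/z = 1/q - iη/q²` exactly. Then `e(-nm²/z)` is the quadratic
phase `e(-nm²/q)` times the Gaussian weight of parameter `nη` at `m/q`, with no error. -/
lemma centre_eq {η : ℝ} {q : ℕ} (hq : 0 < q) :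
    (centreRe η q + centreIm η q * Complex.I : ℂ) = q ^ 2 / (q - η * Complex.I) ∧
      (q - η * Complex.I : ℂ) ≠ 0 := by
  have hq' : (0 : ℝ) < q := by exact_mod_cast hq
  have h0 : (q - η * Complex.I : ℂ) ≠ 0 := by
    intro h
    have := congrArg Complex.re h
    simp at this
    omega
  refine ⟨?_, h0⟩
  have hd : ((q : ℂ) ^ 2 + (η : ℂ) ^ 2) ≠ 0 := by
    have : (0 : ℝ) < (q : ℝ) ^ 2 + η ^ 2 := by positivity
    exact_mod_cast this.ne'
  rw [centreRe, centreIm]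
  push_cast
  field_simp
  linear_combination (-((q : ℂ) ^ 2 * (η : ℂ) ^ 2)) * Complex.I_sq

lemma centreIm_ge {η : ℝ} (hη : 0 < η) (hη1 : η ≤ 1) {q : ℕ} (hq : 0 < q) :
    η / 2 ≤ centreIm η q := by
  have hq' : (1 : ℝ) ≤ q := by exact_mod_cast hq
  rw [centreIm, div_le_div_iff₀ two_pos (by positivity)]
  have : η ^ 2 ≤ (q : ℝ) ^ 2 := by gcongr; linarith
  nlinarith

lemma centreIm_le {η : ℝ} (hη : 0 < η) {q : ℕ} (hq : 0 < q) : centreIm η q ≤ η := by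
  have hq' : (1 : ℝ) ≤ q := by exact_mod_cast hq
  rw [centreIm, div_le_iff₀ (by positivity)]
  have : 0 < η ^ 3 := by positivity
  nlinarith

lemma abs_centreRe_sub_le {η : ℝ} (hη : 0 < η) (hη1 : η ≤ 1) {q : ℕ} (hq : 0 < q) :
    |centreRe η q - q| ≤ 1 := by
  have hq' : (1 : ℝ) ≤ q := by exact_mod_cast hq
  have e : centreRe η q - q = -(q * η ^ 2 / (q ^ 2 + η ^ 2)) := by
    rw [centreRe]; field_simp; ring
  rw [e, abs_neg, abs_of_nonneg (by positivity), div_le_one (by positivity)]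
  have : η ^ 2 ≤ 1 := by nlinarith
  nlinarith

/-- Taylor series of `-log(1 - w)`, summed over `m` for each harmonic; this is the source of the
minus sign. The term `n = 0` is zero because division by zero gives zero. -/
lemma hasSum_poissonMean {η : ℝ} (hη : 0 < η) {q : ℕ} (hq : 0 < q) :
    HasSum (fun n : ℕ => (Complex.exp (n * (2 * π * Complex.I *
      (centreRe η q + centreIm η q * Complex.I))) / n * weightedGaussSum (n * η) n q).im)
      (-(π * poissonMean η q)) := by
  have hq' : (0 : ℝ) < q := by exact_mod_cast hq
  have hqC : (q : ℂ) ≠ 0 := by exact_mod_cast hq.ne'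
  obtain ⟨hz, hz0⟩ := centre_eq (η := η) hq
  set z : ℂ := centreRe η q + centreIm η q * Complex.I with hzdef
  have hzim : 0 < z.im := by
    have : z.im = centreIm η q := by simp [hzdef]
    rw [this, centreIm]
    positivity
  have hm : ∀ m : ℤ, HasSum (fun n : ℕ => Complex.exp (n * (2 * π * Complex.I * z)) / n *
      (gaussWeight (n * η) (m / q) * expTwoPi (-(n * m ^ 2 / q))))
      (-Complex.log (oneSubExp (z - (m ^ 2 : ℝ) / z))) := by
    intro m
    have him := sub_div_im_pos (sq_nonneg (m : ℝ)) hzim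
    have h1 : ‖Complex.exp (2 * π * Complex.I * (z - (m ^ 2 : ℝ) / z))‖ < 1 := by
      rw [norm_exp_two_pi_I, Real.exp_lt_one_iff]
      have : 0 < 2 * π * (z - (m ^ 2 : ℝ) / z).im := by positivity
      linarith
    have h2 := Complex.hasSum_taylorSeries_neg_log h1
    rw [oneSubExp]
    convert h2 using 2 with n
    rw [div_mul_eq_mul_div]
    congr 1
    rw [gaussWeight, expTwoPi, Complex.ofReal_exp, ← Complex.exp_add, ← Complex.exp_add,
      ← Complex.exp_nat_mul]
    congr 1
    have hzinv : ((m ^ 2 : ℝ) : ℂ) / z = m ^ 2 * (q - η * Complex.I) / q ^ 2 := by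
      rw [hz]
      push_cast
      field_simp
    rw [hzinv]
    push_cast
    field_simp
    linear_combination (-η * n * m ^ 2 : ℂ) * Complex.I_sq
  have hall := hasSum_sum (s := Finset.Ico (-(q : ℤ)) q) fun m _ => hm m
  have him := Complex.hasSum_im hall
  convert him using 1
  · ext n
    rw [weightedGaussSum, Finset.mul_sum]
  · rw [poissonMean, Complex.im_sum, ← mul_assoc, mul_inv_cancel₀ Real.pi_ne_zero, one_mul,
      ← Finset.sum_neg_distrib]
    simp only [Complex.neg_im]
    rfl

/-- The centre differs from `q + iη` by `η²/(q - iη)` in absolute value, and `e(n(q + iη))` is real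
and positive because `q` is an integer. -/
lemma norm_exp_centre_sub_le {η : ℝ} (hη : 0 < η) (hη1 : η ≤ 1) {q : ℕ} (hq : 0 < q) (n : ℕ) :
    ‖Complex.exp (n * (2 * π * Complex.I * (centreRe η q + centreIm η q * Complex.I)))
      - Real.exp (-(2 * π * (n * η)))‖ ≤ Real.exp (-(n * η)) * (2 * π * n * (η / q)) := by
  have hq' : (1 : ℝ) ≤ q := by exact_mod_cast hq
  obtain ⟨hz, hz0⟩ := centre_eq (η := η) hq
  have hπ := Real.pi_gt_three
  have hn : (0 : ℝ) ≤ n := by positivity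
  have hnη : 0 ≤ n * η := by positivity
  have htarget : ((Real.exp (-(2 * π * (n * η))) : ℝ) : ℂ)
      = Complex.exp (n * (2 * π * Complex.I * (q + η * Complex.I))) := by
    have e : (n * (2 * π * Complex.I * (q + η * Complex.I)) : ℂ)
        = ((-(2 * π * (n * η)) : ℝ) : ℂ) + ((n * q : ℕ) : ℂ) * (2 * π * Complex.I) := by
      push_cast
      linear_combination (2 * π * n * η : ℂ) * Complex.I_sq
    rw [e, Complex.exp_add, Complex.exp_nat_mul_two_pi_mul_I, mul_one, Complex.ofReal_exp]
  rw [htarget]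
  refine (norm_exp_sub_exp_le (c := -(n * η)) ?_ ?_).trans ?_
  · have e : (n * (2 * π * Complex.I * (centreRe η q + centreIm η q * Complex.I)) : ℂ).re
        = -(2 * π * (n * centreIm η q)) := by
      simp; ring
    rw [e]
    have := centreIm_ge hη hη1 hq
    have h2 : n * (η / 2) ≤ n * centreIm η q := by gcongr
    nlinarith
  · have e : (n * (2 * π * Complex.I * (q + η * Complex.I)) : ℂ).re = -(2 * π * (n * η)) := by
      simp; ring
    rw [e]
    nlinarith
  · gcongr
    have e : (n * (2 * π * Complex.I * (centreRe η q + centreIm η q * Complex.I)) -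
        n * (2 * π * Complex.I * (q + η * Complex.I)) : ℂ)
        = ((2 * π * n : ℝ) : ℂ) * (-Complex.I * ((η ^ 2 : ℝ) : ℂ) / (q - η * Complex.I)) := by
      have hz2 : (q ^ 2 / (q - η * Complex.I) - (q + η * Complex.I) : ℂ)
          = -(η ^ 2 / (q - η * Complex.I)) := by
        rw [div_sub' hz0, ← neg_div]
        congr 1
        linear_combination (η ^ 2 : ℂ) * Complex.I_sq
      rw [hz]
      push_cast
      linear_combination (2 * π * Complex.I * n : ℂ) * hz2
    rw [e, norm_mul, norm_div, norm_mul, norm_neg, Complex.norm_I, one_mul, Complex.norm_real,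
      Complex.norm_real, Real.norm_of_nonneg (by positivity), Real.norm_of_nonneg (by positivity)]
    gcongr
    · nlinarith
    · have := Complex.re_le_norm (q - η * Complex.I)
      simpa using this

/-- The contribution of the `n`-th harmonic, divided by `√q`. -/
noncomputable def harmonicWeight (η : ℝ) (n : ℕ) : ℝ :=
  π⁻¹ * (Real.exp (-(2 * π * (n * η))) / (n * √(2 * n)))

lemma harmonicWeight_nonneg (η : ℝ) (n : ℕ) : 0 ≤ harmonicWeight η n := by
  unfold harmonicWeight
  have := Real.pi_pos
  positivity

/-- The real number `-Im (e(-1/8) D)` for the dual sum `D`. -/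
noncomputable def dualIm (η : ℝ) (n q : ℕ) : ℝ :=
  -(expTwoPi (-1 / 8) * dualGaussSum (n * η) n q).im

lemma abs_dualIm_le {η : ℝ} (hη : 0 < η) (n q : ℕ) : |dualIm η n q| ≤ 4 * n := by
  rw [dualIm, abs_neg]
  refine (Complex.abs_im_le_norm _).trans ?_
  rw [norm_mul, norm_expTwoPi, one_mul]
  exact norm_dualGaussSum_le (by positivity) n q

lemma harmonicWeight_mul_le {η : ℝ} (hη : 0 < η) (n : ℕ) :
    harmonicWeight η n * (4 * n) ≤ 2 * Real.exp (-(n * η)) := by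
  rcases Nat.eq_zero_or_pos n with rfl | hn
  · simp [harmonicWeight]
  have hn' : (1 : ℝ) ≤ n := by exact_mod_cast hn
  have h1 : (1 : ℝ) ≤ √(2 * n) := by rw [Real.one_le_sqrt]; linarith
  have h2 : Real.exp (-(2 * π * (n * η))) ≤ Real.exp (-(n * η)) := by
    apply Real.exp_le_exp.2
    have : 0 ≤ n * η := by positivity
    nlinarith [Real.pi_gt_three]
  have hπ : π⁻¹ ≤ 1 / 2 := by
    rw [inv_le_comm₀ Real.pi_pos (by norm_num)]
    linarith [Real.pi_gt_three]
  have e : harmonicWeight η n * (4 * n) = 4 * (π⁻¹ * (Real.exp (-(2 * π * (n * η))) / √(2 * n))) := by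
    rw [harmonicWeight]; field_simp
  rw [e]
  have h3 : Real.exp (-(2 * π * (n * η))) / √(2 * n) ≤ Real.exp (-(n * η)) :=
    (div_le_self (Real.exp_pos _).le h1).trans h2
  have h4 : π⁻¹ * (Real.exp (-(2 * π * (n * η))) / √(2 * n)) ≤ 1 / 2 * Real.exp (-(n * η)) := by
    gcongr
  linarith

lemma summable_harmonicWeight_mul {η : ℝ} (hη : 0 < η) {f : ℕ → ℝ} (hf : ∀ n, |f n| ≤ 4 * n) :
    Summable fun n => harmonicWeight η n * f n := by
  refine Summable.of_norm_bounded ((summable_exp_neg_mul hη).mul_left 2) fun n => ?_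
  rw [Real.norm_eq_abs, abs_mul, abs_of_nonneg (harmonicWeight_nonneg _ _)]
  exact (mul_le_mul_of_nonneg_left (hf n) (harmonicWeight_nonneg _ _)).trans
    (harmonicWeight_mul_le hη n)

/-- Two replacements are made in each harmonic: the exponential by its value at `q + iη`, and the
Gauss sum by its dual. Summed over `n`, both errors are `O(√q)`, which is the constant `C`. -/
theorem poissonMean_ge : ∃ C : ℝ, 0 < C ∧ ∀ (η : ℝ), 0 < η → η ≤ 1 → ∀ q : ℕ, 0 < q →
    1 ≤ η ^ 4 * q → √q * (∑' n, harmonicWeight η n * dualIm η n q - C) ≤ poissonMean η q := by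
  obtain ⟨C, hC, hG⟩ := weightedGaussSum_approx
  refine ⟨6 * C + 8, by positivity, fun η hη hη1 q hq hηq => ?_⟩
  have hq' : (1 : ℝ) ≤ q := by exact_mod_cast hq
  have hπ := Real.pi_gt_three
  set S := ∑' n : ℕ, Real.exp (-(n * η)) with hSdef
  have hS : HasSum (fun n : ℕ => Real.exp (-(n * η))) S := (summable_exp_neg_mul hη).hasSum
  have hS2 : S ≤ 2 / η := tsum_exp_neg_mul_le hη hη1
  have hmain : HasSum (fun n => π * √q * (harmonicWeight η n * dualIm η n q))
      (π * √q * ∑' n, harmonicWeight η n * dualIm η n q) :=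
    (summable_harmonicWeight_mul hη fun n => abs_dualIm_le hη n q).hasSum.mul_left _
  have hdiff := (hasSum_poissonMean hη hq).add hmain
  have hbd : ∀ n : ℕ, ‖(Complex.exp (n * (2 * π * Complex.I *
      (centreRe η q + centreIm η q * Complex.I))) / n * weightedGaussSum (n * η) n q).im +
      π * √q * (harmonicWeight η n * dualIm η n q)‖
      ≤ (4 * π * η + 3 * C * (q : ℝ) ^ (1 / 4 : ℝ)) * Real.exp (-(n * η)) := by
    intro n
    rcases Nat.eq_zero_or_pos n with rfl | hn
    · simp [harmonicWeight]
      positivity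
    have hn' : (1 : ℝ) ≤ n := by exact_mod_cast hn
    have hn0 : (n : ℝ) ≠ 0 := by positivity
    set E := Complex.exp (n * (2 * π * Complex.I *
      (centreRe η q + centreIm η q * Complex.I))) with hE
    set G := weightedGaussSum (n * η) n q with hGdef
    set D := dualGaussSum (n * η) n q with hDdef
    set r := Real.exp (-(2 * π * (n * η))) with hr
    have e1 : π * √q * (harmonicWeight η n * dualIm η n q)
        = -((r : ℂ) / n * (√(q / (2 * n)) * expTwoPi (-1 / 8) * D)).im := by
      have e2 : ((r : ℂ) / n * (√(q / (2 * n)) * expTwoPi (-1 / 8) * D))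
          = ((r / n * √(q / (2 * n)) : ℝ) : ℂ) * (expTwoPi (-1 / 8) * D) := by push_cast; ring
      rw [e2, Complex.im_ofReal_mul, dualIm, harmonicWeight, Real.sqrt_div (by positivity),
        ← hr, ← hDdef]
      field_simp
    have e3 : (E / n * G).im + π * √q * (harmonicWeight η n * dualIm η n q)
        = ((E - r) / n * G + (r : ℂ) / n * (G - √(q / (2 * n)) * expTwoPi (-1 / 8) * D)).im := by
      rw [e1, ← sub_eq_add_neg, ← Complex.sub_im]
      congr 1
      ring
    rw [e3, Real.norm_eq_abs]
    refine (Complex.abs_im_le_norm _).trans ((norm_add_le _ _).trans ?_)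
    rw [add_mul]
    have hnn : ‖(n : ℂ)‖ = n := by simp
    refine add_le_add ?_ ?_
    · rw [norm_mul, norm_div, hnn]
      calc _ ≤ Real.exp (-(n * η)) * (2 * π * n * (η / q)) / n * (2 * q) := by
            gcongr
            · exact norm_exp_centre_sub_le hη hη1 hq n
            · exact norm_weightedGaussSum_le (by positivity) n q
        _ = _ := by field_simp; ring
    · rw [norm_mul, norm_div, hnn, Complex.norm_real, Real.norm_of_nonneg (Real.exp_pos _).le]
      set κ := n * η with hκ
      have hκ0 : 0 ≤ κ := by positivity
      have hk : r * (κ + κ ^ 2) ≤ 3 * Real.exp (-κ) := by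
        have h1 : κ ≤ Real.exp κ := by linarith [Real.add_one_le_exp κ]
        have h2 : κ ^ 2 ≤ Real.exp (2 * κ) := by
          rw [two_mul, Real.exp_add]; nlinarith
        have h3 : Real.exp κ ≤ Real.exp (2 * κ) := Real.exp_le_exp.2 (by linarith)
        have h4 : r ≤ Real.exp (-(3 * κ)) := Real.exp_le_exp.2 (by nlinarith)
        calc r * (κ + κ ^ 2) ≤ Real.exp (-(3 * κ)) * (2 * Real.exp (2 * κ)) := by
              gcongr; linarith
          _ = 2 * Real.exp (-κ) := by
              rw [mul_left_comm, ← Real.exp_add]; ring_nf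
          _ ≤ _ := by linarith [Real.exp_pos (-κ)]
      have hnq : (n : ℝ)⁻¹ * (n * q : ℝ) ^ (1 / 4 : ℝ) ≤ (q : ℝ) ^ (1 / 4 : ℝ) := by
        rw [Real.mul_rpow (by positivity) (by positivity), ← mul_assoc]
        have : (n : ℝ)⁻¹ * (n : ℝ) ^ (1 / 4 : ℝ) ≤ 1 := by
          rw [inv_mul_le_iff₀ (by positivity), mul_one]
          calc (n : ℝ) ^ (1 / 4 : ℝ) ≤ (n : ℝ) ^ (1 : ℝ) :=
                Real.rpow_le_rpow_of_exponent_le hn' (by norm_num)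
            _ = n := Real.rpow_one _
        exact mul_le_of_le_one_left (by positivity) this
      calc _ ≤ r / n * (C * (κ + κ ^ 2) * (n * q : ℝ) ^ (1 / 4 : ℝ)) := by
            gcongr
            exact hG κ hκ0 n q hn hq
        _ = C * (r * (κ + κ ^ 2)) * ((n : ℝ)⁻¹ * (n * q : ℝ) ^ (1 / 4 : ℝ)) := by ring
        _ ≤ C * (3 * Real.exp (-κ)) * (q : ℝ) ^ (1 / 4 : ℝ) := by gcongr
        _ = _ := by ring
  have h1 := tsum_of_norm_bounded (hS.mul_left
    (4 * π * η + 3 * C * (q : ℝ) ^ (1 / 4 : ℝ))) hbd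
  rw [hdiff.tsum_eq, Real.norm_eq_abs] at h1
  have h2 := (abs_le.1 h1).2
  -- The hypothesis `1 ≤ η⁴q` enters here: the reciprocity error `q^{1/4}`, multiplied by the `2/η`
  -- from summing over `n`, stays below `2√q`.
  have hq4 : (q : ℝ) ^ (1 / 4 : ℝ) ≤ √q * η := by
    have hx : (0 : ℝ) ≤ (q : ℝ) ^ (1 / 4 : ℝ) := by positivity
    have hx4 : ((q : ℝ) ^ (1 / 4 : ℝ)) ^ 2 = √q := by
      rw [← Real.rpow_natCast, ← Real.rpow_mul (by positivity), Real.sqrt_eq_rpow]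
      norm_num
    set X := (q : ℝ) ^ (1 / 4 : ℝ) with hX
    rw [← hx4]
    have hX4 : X ^ 4 = q := by
      rw [show X ^ 4 = (X ^ 2) ^ 2 by ring, hx4, Real.sq_sqrt (by positivity)]
    have h5 : 1 ≤ (η * X) ^ 4 := by rw [mul_pow, hX4]; exact hηq
    have h6 : 1 ≤ η * X := by
      by_contra! h
      have := pow_lt_one₀ (by positivity) h (n := 4) (by norm_num)
      linarith
    nlinarith
  have hsq1 : 1 ≤ √(q : ℝ) := by rw [Real.one_le_sqrt]; exact hq'
  have h3 : (4 * π * η + 3 * C * (q : ℝ) ^ (1 / 4 : ℝ)) * S ≤ √q * (8 * π + 6 * C) := by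
    calc _ ≤ (4 * π * η + 3 * C * (√q * η)) * (2 / η) := by gcongr
      _ = 8 * π + √q * (6 * C) := by field_simp; ring
      _ ≤ _ := by nlinarith
  have h4 : √q * (8 * π + 6 * C) ≤ π * (√q * (8 + 6 * C)) := by
    have : 0 ≤ √(q : ℝ) * (6 * C) := by positivity
    nlinarith
  have hfin : π * (√q * (∑' n, harmonicWeight η n * dualIm η n q - (6 * C + 8)))
      ≤ π * poissonMean η q := by linarith
  exact le_of_mul_le_mul_left hfin Real.pi_pos

/-! ### Averaging over multiples of `Q`: resonance. -/

lemma norm_geom_sum_le_of_pow_eq_one {ζ : ℂ} {N : ℕ} (hN : 0 < N) (h1 : ζ ^ N = 1) (hζ : ζ ≠ 1)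
    (K : ℕ) : ‖∑ k ∈ Finset.range K, ζ ^ k‖ ≤ N := by
  have hn : ‖ζ‖ = 1 := Complex.norm_eq_one_of_pow_eq_one h1 hN.ne'
  have e : ∑ k ∈ Finset.range K, ζ ^ k = ∑ k ∈ Finset.range (K % N), ζ ^ k := by
    have : ζ ^ K = ζ ^ (K % N) := by
      conv_lhs => rw [← Nat.div_add_mod K N, pow_add, pow_mul, h1, one_pow, one_mul]
    rw [geom_sum_eq hζ, geom_sum_eq hζ, this]
  rw [e]
  refine (norm_sum_le_of_le (f := fun k => ζ ^ k) _
    (fun k _ => (by rw [norm_pow, hn, one_pow] : _ ≤ (1 : ℝ)))).trans ?_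
  simp only [Finset.sum_const, Finset.card_range, nsmul_eq_mul, mul_one]
  exact_mod_cast (Nat.mod_lt K hN).le

lemma dualIm_eq_sum (η : ℝ) (n q : ℕ) : dualIm η n q =
    ∑ s ∈ Finset.Ico (-(2 * n : ℤ)) (2 * n), gaussWeight (n * η) (s / (2 * n)) *
      (-(expTwoPi (-1 / 8) * expTwoPi (q * s ^ 2 / (4 * n))).im) := by
  rw [dualIm, dualGaussSum, Finset.mul_sum, Complex.im_sum, ← Finset.sum_neg_distrib]
  refine Finset.sum_congr rfl fun s _ => ?_
  rw [mul_left_comm, Complex.im_ofReal_mul, mul_neg]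

/-- This sign decides the direction of the theorem: resonant terms push the sawtooth sum up, hence
the lattice count down. -/
lemma half_le_neg_im_expTwoPi : 1 / 2 ≤ -(expTwoPi (-1 / 8)).im := by
  have h : expTwoPi (-1 / 8) = Complex.exp (((-(π / 4) : ℝ) : ℂ) * Complex.I) := by
    rw [expTwoPi]; push_cast; ring_nf
  rw [h, Complex.exp_ofReal_mul_I_im, Real.sin_neg, neg_neg, Real.sin_pi_div_four]
  have : (1 : ℝ) ≤ √2 := by rw [Real.one_le_sqrt]; norm_num
  linarith

/-- Averaging over multiples of `Q`: each dual point contributes at least `-4n`, and at least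
a positive proportion of `K` if it resonates. -/
lemma sum_neg_im_ge {n : ℕ} (hn : 0 < n) (Q K : ℕ) (s : ℤ) :
    -(4 * n : ℝ) ≤ ∑ k ∈ Finset.range K,
        (-(expTwoPi (-1 / 8) * expTwoPi ((Q * (k + 1) : ℕ) * s ^ 2 / (4 * n))).im) ∧
      ((4 * n : ℤ) ∣ Q * s ^ 2 → (K : ℝ) / 2 ≤ ∑ k ∈ Finset.range K,
        (-(expTwoPi (-1 / 8) * expTwoPi ((Q * (k + 1) : ℕ) * s ^ 2 / (4 * n))).im)) := by
  have hn' : (0 : ℝ) < n := by exact_mod_cast hn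
  set ζ := expTwoPi (Q * s ^ 2 / (4 * n)) with hζ
  have hk : ∀ k : ℕ, expTwoPi ((Q * (k + 1) : ℕ) * s ^ 2 / (4 * n)) = ζ ^ (k + 1) := by
    intro k
    rw [hζ, ← expTwoPi_nat_mul]
    congr 1
    push_cast
    ring
  simp_rw [hk]
  have hres : (4 * n : ℤ) ∣ Q * s ^ 2 → ζ = 1 := by
    rintro ⟨t, ht⟩
    have ht' : (Q * s ^ 2 : ℝ) = 4 * n * t := by exact_mod_cast ht
    rw [hζ, ht', mul_div_cancel_left₀ _ (by positivity), expTwoPi_int]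
  have hone : ζ = 1 → (K : ℝ) / 2 ≤ ∑ k ∈ Finset.range K, (-(expTwoPi (-1 / 8) * ζ ^ (k + 1)).im) := by
    intro h
    simp only [h, one_pow, mul_one, Finset.sum_const, Finset.card_range, nsmul_eq_mul]
    have := mul_le_mul_of_nonneg_left half_le_neg_im_expTwoPi (Nat.cast_nonneg (α := ℝ) K)
    linarith
  refine ⟨?_, fun h => hone (hres h)⟩
  by_cases h : ζ = 1
  · refine le_trans ?_ (hone h)
    have : (0 : ℝ) ≤ K / 2 := by positivity
    linarith
  · have hpow : ζ ^ (4 * n) = 1 := by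
      rw [hζ, ← expTwoPi_nat_mul, ← expTwoPi_int (Q * s ^ 2)]
      congr 1
      push_cast
      field_simp
    have hb := norm_geom_sum_le_of_pow_eq_one (by omega) hpow h K
    have e : ∑ k ∈ Finset.range K, (-(expTwoPi (-1 / 8) * ζ ^ (k + 1)).im)
        = -(expTwoPi (-1 / 8) * ζ * ∑ k ∈ Finset.range K, ζ ^ k).im := by
      rw [Finset.mul_sum, Complex.im_sum, ← Finset.sum_neg_distrib]
      refine Finset.sum_congr rfl fun k _ => ?_
      rw [pow_succ', mul_assoc]
    rw [e, neg_le_neg_iff]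
    refine (Complex.im_le_norm _).trans ?_
    rw [norm_mul, norm_mul, norm_expTwoPi, hζ, norm_expTwoPi, one_mul, one_mul, ← hζ]
    push_cast at hb
    exact hb

/-- When `n ∣ Q`, each of the `2n` even values of `s` has `4n ∣ Qs²`, hence resonates, with weight
at least `exp(-2π)` as long as `nη ≤ 1`. Each of the `4n` values of `s` may lose `4n`, which makes
`16n²`. -/
lemma sum_dualIm_ge {n : ℕ} (hn : 0 < n) {η : ℝ} (hη : 0 < η) (Q K : ℕ) :
    (if n ∣ Q ∧ n * η ≤ 1 then Real.exp (-(2 * π)) * K * n else 0) - 16 * n ^ 2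
      ≤ ∑ k ∈ Finset.range K, dualIm η n (Q * (k + 1)) := by
  have hn' : (0 : ℝ) < n := by exact_mod_cast hn
  have hκ : 0 ≤ n * η := by positivity
  simp_rw [dualIm_eq_sum]
  rw [Finset.sum_comm]
  simp_rw [← Finset.mul_sum]
  set I := Finset.Ico (-(2 * n : ℤ)) (2 * n) with hI
  have hcard : I.card = 4 * n := by rw [hI, Int.card_Ico]; omega
  have hterm : ∀ s ∈ I, (if n ∣ Q ∧ n * η ≤ 1 ∧ Even s then Real.exp (-(2 * π)) * K / 2 else 0)
      - 4 * n ≤ gaussWeight (n * η) (s / (2 * n)) * ∑ k ∈ Finset.range K,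
        (-(expTwoPi (-1 / 8) * expTwoPi ((Q * (k + 1) : ℕ) * s ^ 2 / (4 * n))).im) := by
    intro s hs
    obtain ⟨h1, h2⟩ := sum_neg_im_ge hn Q K s
    have hg0 := gaussWeight_pos (n * η) (s / (2 * n))
    have hg1 := gaussWeight_le_one hκ (s / (2 * n))
    split_ifs with h
    · obtain ⟨⟨a, rfl⟩, hle, ⟨b, rfl⟩⟩ := h
      have h3 := h2 ⟨a * b ^ 2, by push_cast; ring⟩
      have hg : Real.exp (-(2 * π)) ≤ gaussWeight (n * η) ((b + b : ℤ) / (2 * n)) := by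
        rw [gaussWeight]
        apply Real.exp_le_exp.2
        rw [hI, Finset.mem_Ico] at hs
        have a1 : (-(2 * n) : ℝ) ≤ (b + b : ℤ) := by exact_mod_cast hs.1
        have a2 : ((b + b : ℤ) : ℝ) ≤ 2 * n := by exact_mod_cast hs.2.le
        have hu : (((b + b : ℤ) : ℝ) / (2 * n)) ^ 2 ≤ 1 := by
          rw [sq_le_one_iff_abs_le_one, abs_le]
          constructor
          · rw [le_div_iff₀ (by positivity)]; linarith
          · rw [div_le_iff₀ (by positivity)]; linarith
        have : 2 * π * (n * η) * (((b + b : ℤ) : ℝ) / (2 * n)) ^ 2 ≤ 2 * π * 1 * 1 := by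
          gcongr
        linarith
      have : Real.exp (-(2 * π)) * (K / 2) ≤ gaussWeight (n * η) ((b + b : ℤ) / (2 * n)) *
          ∑ k ∈ Finset.range K, (-(expTwoPi (-1 / 8) *
            expTwoPi ((n * a * (k + 1) : ℕ) * (b + b : ℤ) ^ 2 / (4 * n))).im) :=
        mul_le_mul hg h3 (by positivity) hg0.le
      linarith
    · have : gaussWeight (n * η) (s / (2 * n)) * -(4 * n : ℝ) ≤ _ :=
        mul_le_mul_of_nonneg_left h1 hg0.le
      nlinarith
  refine le_trans ?_ (Finset.sum_le_sum hterm)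
  rw [Finset.sum_sub_distrib, Finset.sum_const, hcard, nsmul_eq_mul]
  have h4 : (((4 * n : ℕ) : ℝ) * (4 * n)) = 16 * n ^ 2 := by push_cast; ring
  rw [h4]
  refine sub_le_sub_right ?_ _
  split_ifs with h
  · simp only [h.1, h.2, true_and]
    rw [← Finset.sum_filter, Finset.sum_const, nsmul_eq_mul]
    have hc : 2 * n ≤ (I.filter (fun s => Even s)).card := by
      have h5 : (Finset.Ico (-(n : ℤ)) n).image (fun b => b + b) ⊆ I.filter (fun s => Even s) := by
        intro s hs
        obtain ⟨b, hb, rfl⟩ := Finset.mem_image.1 hs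
        rw [Finset.mem_Ico] at hb
        rw [Finset.mem_filter, hI, Finset.mem_Ico]
        exact ⟨⟨by omega, by omega⟩, ⟨b, rfl⟩⟩
      have h6 := Finset.card_le_card h5
      rw [Finset.card_image_of_injective _ (fun a b h => by
          have h' : a + a = b + b := h
          omega), Int.card_Ico] at h6
      omega
    have hc' : (2 * n : ℝ) ≤ (I.filter (fun s => Even s)).card := by exact_mod_cast hc
    have : (2 * n : ℝ) * (Real.exp (-(2 * π)) * K / 2) ≤ _ :=
      mul_le_mul_of_nonneg_right hc' (by positivity)
    linarith
  · refine Finset.sum_nonneg fun s _ => ?_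
    split_ifs <;> positivity

/-- Controls the total loss from non-resonant terms: summed over `n` it is at most `16/η²`,
independently of the number of multiples averaged. -/
lemma harmonicWeight_mul_sq_le {η : ℝ} (hη : 0 < η) (n : ℕ) :
    harmonicWeight η n * (16 * n ^ 2) ≤ 8 / η * Real.exp (-(n * η)) := by
  rcases Nat.eq_zero_or_pos n with rfl | hn
  · simp [harmonicWeight]; positivity
  have hn' : (1 : ℝ) ≤ n := by exact_mod_cast hn
  have h1 : (1 : ℝ) ≤ √(2 * n) := by rw [Real.one_le_sqrt]; linarith
  have hπ : π⁻¹ ≤ 1 / 2 := by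
    rw [inv_le_comm₀ Real.pi_pos (by norm_num)]
    linarith [Real.pi_gt_three]
  have h2 : Real.exp (-(2 * π * (n * η))) * (n * η) ≤ Real.exp (-(n * η)) := by
    have h3 : n * η ≤ Real.exp (n * η) := by linarith [Real.add_one_le_exp (n * η)]
    calc _ ≤ Real.exp (-(2 * π * (n * η))) * Real.exp (n * η) := by gcongr
      _ = Real.exp (-(2 * π * (n * η)) + n * η) := (Real.exp_add _ _).symm
      _ ≤ _ := by
        apply Real.exp_le_exp.2
        have : 0 ≤ n * η := by positivity
        nlinarith [Real.pi_gt_three]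
  have e : harmonicWeight η n * (16 * n ^ 2)
      = 16 / η * (π⁻¹ * ((Real.exp (-(2 * π * (n * η))) * (n * η)) / √(2 * n))) := by
    rw [harmonicWeight]; field_simp
  rw [e]
  have h4 : (Real.exp (-(2 * π * (n * η))) * (n * η)) / √(2 * n) ≤ Real.exp (-(n * η)) :=
    (div_le_self (by positivity) h1).trans h2
  calc _ ≤ 16 / η * (1 / 2 * Real.exp (-(n * η))) := by gcongr
    _ = _ := by ring

/-- The sum of `e^{-1/2}` over the divisors `e ≤ Y` of `Q`. -/
noncomputable def divisorSum (Q Y : ℕ) : ℝ :=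
  ∑ e ∈ Q.divisors.filter (· ≤ Y), (√e)⁻¹

theorem exists_tsum_dualIm_ge : ∃ c : ℝ, 0 < c ∧ ∀ Q Y : ℕ, 0 < Q → 0 < Y →
    ∃ k, 0 < k ∧ k ≤ Y ^ 2 ∧
      c * divisorSum Q Y - 16 ≤ ∑' n, harmonicWeight (Y : ℝ)⁻¹ n * dualIm (Y : ℝ)⁻¹ n (Q * k) := by
  -- One factor `exp(-2π)` comes from the damping of the harmonic and one from the Gaussian weight,
  -- both for `nη ≤ 1`; the `√2` comes from `√(2n)`.
  refine ⟨π⁻¹ * Real.exp (-(4 * π)) / √2, by positivity, fun Q Y hQ hY => ?_⟩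
  set c := π⁻¹ * Real.exp (-(4 * π)) / √2 with hc
  have hY' : (1 : ℝ) ≤ Y := by exact_mod_cast hY
  set η := (Y : ℝ)⁻¹ with hη
  have hη0 : 0 < η := by positivity
  have hη1 : η ≤ 1 := inv_le_one_of_one_le₀ hY'
  -- With `η = 1/Y`, the total loss `16/η²` is then exactly 16 per multiple.
  set K := Y ^ 2 with hK
  have hsum : ∀ k, Summable fun n => harmonicWeight η n * dualIm η n (Q * (k + 1)) := fun k =>
    summable_harmonicWeight_mul hη0 fun n => abs_dualIm_le hη0 n _
  have htot : ∑ k ∈ Finset.range K, ∑' n, harmonicWeight η n * dualIm η n (Q * (k + 1))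
      = ∑' n, harmonicWeight η n * ∑ k ∈ Finset.range K, dualIm η n (Q * (k + 1)) := by
    rw [← Summable.tsum_finsetSum fun k _ => hsum k]
    simp_rw [Finset.mul_sum]
  set D := Q.divisors.filter (· ≤ Y) with hD
  have hexp : Summable fun n : ℕ => 8 / η * Real.exp (-(n * η)) :=
    (summable_exp_neg_mul hη0).mul_left _
  have hind : Summable fun n : ℕ => if n ∈ D then c * K * (√n)⁻¹ else 0 :=
    summable_of_ne_finset_zero (s := D) fun n hn => if_neg hn
  have hle : ∑' n : ℕ, ((if n ∈ D then c * K * (√n)⁻¹ else 0) - 8 / η * Real.exp (-(n * η)))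
      ≤ ∑' n, harmonicWeight η n * ∑ k ∈ Finset.range K, dualIm η n (Q * (k + 1)) := by
    refine Summable.tsum_le_tsum (fun n => ?_) (hind.sub hexp) ?_
    · rcases Nat.eq_zero_or_pos n with rfl | hn
      · have : (0 : ℕ) ∉ D := by simp [hD]
        simp [harmonicWeight, this]
        positivity
      have hn' : (1 : ℝ) ≤ n := by exact_mod_cast hn
      have h1 := mul_le_mul_of_nonneg_left (sum_dualIm_ge hn hη0 Q K) (harmonicWeight_nonneg η n)
      refine le_trans ?_ h1
      rw [mul_sub]
      refine sub_le_sub ?_ (harmonicWeight_mul_sq_le hη0 n)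
      by_cases hnD : n ∈ D
      · have h2 := Finset.mem_filter.1 hnD
        have h3 : n ∣ Q := Nat.dvd_of_mem_divisors h2.1
        have h4 : n * η ≤ 1 := by
          rw [hη, ← div_eq_mul_inv, div_le_one (by positivity)]
          exact_mod_cast h2.2
        rw [if_pos hnD, if_pos ⟨h3, h4⟩, harmonicWeight, Real.sqrt_mul two_pos.le]
        have h5 : Real.exp (-(4 * π)) ≤ Real.exp (-(2 * π * (n * η))) * Real.exp (-(2 * π)) := by
          rw [← Real.exp_add]
          apply Real.exp_le_exp.2
          nlinarith [Real.pi_pos]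
        have e1 : c * K * (√n)⁻¹ = π⁻¹ / √2 * K * (√n)⁻¹ * Real.exp (-(4 * π)) := by
          rw [hc]; ring
        have e2 : π⁻¹ * (Real.exp (-(2 * π * (n * η))) / (n * (√2 * √n))) *
            (Real.exp (-(2 * π)) * K * n)
            = π⁻¹ / √2 * K * (√n)⁻¹ * (Real.exp (-(2 * π * (n * η))) * Real.exp (-(2 * π))) := by
          field_simp
        rw [e1, e2]
        gcongr
      · rw [if_neg hnD]
        refine mul_nonneg (harmonicWeight_nonneg η n) ?_
        split_ifs <;> positivity
    · simp_rw [Finset.mul_sum]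
      exact summable_sum fun k _ => hsum k
  have hval : ∑' n : ℕ, ((if n ∈ D then c * K * (√n)⁻¹ else 0) - 8 / η * Real.exp (-(n * η)))
      ≥ K * (c * divisorSum Q Y - 16) := by
    rw [hind.tsum_sub hexp, tsum_mul_left, tsum_eq_sum (s := D) (fun n hn => if_neg hn)]
    have h1 : ∑ n ∈ D, (if n ∈ D then c * K * (√n)⁻¹ else 0) = K * (c * divisorSum Q Y) := by
      rw [divisorSum, Finset.mul_sum, Finset.mul_sum]
      refine Finset.sum_congr rfl fun n hn => ?_
      rw [if_pos hn]; ring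
    rw [h1]
    have h2 : 8 / η * ∑' n : ℕ, Real.exp (-(n * η)) ≤ K * 16 := by
      calc _ ≤ 8 / η * (2 / η) := by gcongr; exact tsum_exp_neg_mul_le hη0 hη1
        _ = K * 16 := by rw [hη, hK]; push_cast; field_simp; ring
    linarith
  have hK0 : 0 < K := by positivity
  have hfin : ∑ k ∈ Finset.range K, (c * divisorSum Q Y - 16) ≤
      ∑ k ∈ Finset.range K, ∑' n, harmonicWeight η n * dualIm η n (Q * (k + 1)) := by
    rw [htot, Finset.sum_const, Finset.card_range, nsmul_eq_mul]
    exact hval.le.trans hle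
  obtain ⟨k, hk, hk2⟩ := Finset.exists_le_of_sum_le ⟨0, Finset.mem_range.2 hK0⟩ hfin
  exact ⟨k + 1, by omega, by have := Finset.mem_range.1 hk; omega, hk2⟩

theorem exists_sawtooth_sum_ge : ∃ c C : ℝ, 0 < c ∧ 0 < C ∧ ∀ Q Y : ℕ, 0 < Q → 0 < Y → Y ^ 4 ≤ Q →
    C ≤ c * divisorSum Q Y → ∃ q : ℕ, Q ≤ q ∧ q ≤ Q * Y ^ 2 ∧ ∃ R : ℝ, |R - q| ≤ √q + 1 ∧
      √q * (c * divisorSum Q Y - C) ≤ ∑ m ∈ Finset.Ico (-(q : ℤ)) q, sawtooth (R - m ^ 2 / R) := by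
  obtain ⟨c, hc, h1⟩ := exists_tsum_dualIm_ge
  obtain ⟨C, hC, h2⟩ := poissonMean_ge
  -- The 19 is 16 from the averaging, 2 from the tails of the Poisson kernel (`2q` summands, height
  -- at most 1, window `√q`), and 1 for strictness.
  refine ⟨c, C + 19, hc, by positivity, fun Q Y hQ hY hQY hlarge => ?_⟩
  obtain ⟨k, hk0, hkY, hk⟩ := h1 Q Y hQ hY
  have hY' : (1 : ℝ) ≤ Y := by exact_mod_cast hY
  set η := (Y : ℝ)⁻¹ with hη
  have hη0 : 0 < η := by positivity
  have hη1 : η ≤ 1 := inv_le_one_of_one_le₀ hY'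
  have hq : 0 < Q * k := by positivity
  have hQq : Q ≤ Q * k := Nat.le_mul_of_pos_right _ hk0
  have hηq : 1 ≤ η ^ 4 * (Q * k : ℕ) := by
    rw [hη, inv_pow, inv_mul_eq_div, one_le_div (by positivity)]
    exact_mod_cast hQY.trans hQq
  have h3 := h2 η hη0 hη1 (Q * k) hq hηq
  refine ⟨Q * k, hQq, Nat.mul_le_mul_left _ hkY, ?_⟩
  set q := Q * k with hqdef
  have hq' : (1 : ℝ) ≤ q := by exact_mod_cast hq
  have hsq : 0 < √(q : ℝ) := by positivity
  have hy0 : 0 < centreIm η q := by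
    have := centreIm_ge hη0 hη1 hq; linarith
  have hy1 := centreIm_le hη0 hq
  have hcard : ((Finset.Ico (-(q : ℤ)) q).card : ℝ) = 2 * q := by
    rw [Int.card_Ico]
    have : ((q : ℤ) - -q).toNat = 2 * q := by omega
    rw [this]; push_cast; rfl
  obtain ⟨R, hR, hR2⟩ := exists_sum_sawtooth_gt (Finset.Ico (-(q : ℤ)) q) (centreRe η q) hy0 hsq
    (M := √q * (c * divisorSum Q Y - (C + 19))) (mul_nonneg hsq.le (by linarith)) (by
      refine lt_of_lt_of_le ?_ h3
      rw [hcard]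
      have e : 2 * (q : ℝ) * (centreIm η q / √q) = √q * (2 * centreIm η q) := by
        have := Real.mul_self_sqrt (by positivity : (0 : ℝ) ≤ q)
        field_simp
        linear_combination (-1 : ℝ) * this
      rw [e, ← mul_add]
      exact mul_lt_mul_of_pos_left (by linarith) hsq)
  refine ⟨R, ?_, hR2.le⟩
  have h4 := abs_centreRe_sub_le hη0 hη1 hq
  calc |R - q| ≤ |R - centreRe η q| + |centreRe η q - q| := abs_sub_le _ _ _
    _ ≤ _ := add_le_add hR h4

/-! ### From lattice points to the sawtooth sum. -/

lemma volume_real_parabolicRegion : volume.real parabolicRegion = 8 / 3 := by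
  have hmeas : MeasurableSet parabolicRegion := by
    unfold parabolicRegion
    exact measurableSet_le (by fun_prop) (by fun_prop)
  have hslice : ∀ x : ℝ, volume (Prod.mk x ⁻¹' parabolicRegion) = ENNReal.ofReal (2 * (1 - x ^ 2)) := by
    intro x
    have : Prod.mk x ⁻¹' parabolicRegion = Set.Icc (-(1 - x ^ 2)) (1 - x ^ 2) := by
      ext y
      simp [parabolicRegion, abs_le]
    rw [this, Real.volume_Icc]
    congr 1
    ring
  have hvol : volume parabolicRegion = ENNReal.ofReal (8 / 3) := by
    rw [Measure.volume_eq_prod, Measure.prod_apply hmeas]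
    simp_rw [hslice]
    have h1 : ∫⁻ x : ℝ, ENNReal.ofReal (2 * (1 - x ^ 2))
        = ∫⁻ x in Set.Ioc (-1 : ℝ) 1, ENNReal.ofReal (2 * (1 - x ^ 2)) := by
      rw [← lintegral_indicator measurableSet_Ioc]
      refine lintegral_congr fun x => ?_
      by_cases hx : x ∈ Set.Ioc (-1 : ℝ) 1
      · rw [Set.indicator_of_mem hx]
      · rw [Set.indicator_of_notMem hx, ENNReal.ofReal_eq_zero]
        by_contra! h
        have h2 : x ^ 2 < 1 := by linarith
        rw [sq_lt_one_iff_abs_lt_one, abs_lt] at h2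
        exact hx ⟨h2.1, h2.2.le⟩
    rw [h1, ← ofReal_integral_eq_lintegral_ofReal]
    · rw [← intervalIntegral.integral_of_le (by norm_num)]
      congr 1
      simp
      norm_num
    · exact (by fun_prop : Continuous fun x : ℝ => 2 * (1 - x ^ 2)).integrableOn_Ioc
    · refine (ae_restrict_iff' measurableSet_Ioc).2 (Eventually.of_forall fun x hx => ?_)
      have : x ^ 2 ≤ 1 := by nlinarith [hx.1, hx.2]
      simp only [Pi.zero_apply]
      linarith
  rw [measureReal_def, hvol, ENNReal.toReal_ofReal (by norm_num)]

/-- Column `m` holds `2⌊t⌋ + 1 = 2(t - ψ(t))` points with `t = R - m²/R`. Only an upper bound is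
needed for a large negative discrepancy. -/
lemma latticeCount_le {R : ℝ} (hR : 0 < R) :
    (latticeCount parabolicRegion R : ℝ) ≤
      ∑ m ∈ Finset.Icc (-⌊R⌋) ⌊R⌋, (2 * ((R - m ^ 2 / R) - sawtooth (R - m ^ 2 / R))) := by
  set T : Finset (ℤ × ℤ) := (Finset.Icc (-⌊R⌋) ⌊R⌋).biUnion fun m =>
    {m} ×ˢ Finset.Icc (-⌊R - (m : ℝ) ^ 2 / R⌋) ⌊R - (m : ℝ) ^ 2 / R⌋ with hT
  have hsub : {n : ℤ × ℤ | R⁻¹ • ((n.1 : ℝ), (n.2 : ℝ)) ∈ parabolicRegion} ⊆ (T : Set (ℤ × ℤ)) := by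
    rintro ⟨m, k⟩ h
    simp only [parabolicRegion, Set.mem_ofPred_eq, Prod.smul_mk, smul_eq_mul, abs_mul, abs_inv,
      abs_of_pos hR] at h
    have h1 : |(k : ℝ)| ≤ R - (m : ℝ) ^ 2 / R := by
      have h2 := mul_le_mul_of_nonneg_left h hR.le
      rw [mul_inv_cancel_left₀ hR.ne'] at h2
      refine h2.trans_eq ?_
      field_simp
    have h2 : |(m : ℝ)| ≤ R := by
      have h3 : (m : ℝ) ^ 2 / R ≤ R := by linarith [abs_nonneg (k : ℝ)]
      rw [div_le_iff₀ hR] at h3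
      exact abs_le_of_sq_le_sq (by nlinarith) hR.le
    rw [abs_le] at h1 h2
    simp only [hT, Finset.coe_biUnion, Set.mem_iUnion]
    refine ⟨m, ?_, ?_⟩
    · simp only [Finset.coe_Icc, Set.mem_Icc]
      exact ⟨by rw [neg_le, Int.le_floor]; push_cast; linarith, Int.le_floor.2 h2.2⟩
    · simp only [Finset.coe_product, Finset.coe_singleton, Finset.coe_Icc, Set.mem_prod,
        Set.mem_singleton_iff, true_and, Set.mem_Icc]
      exact ⟨by rw [neg_le, Int.le_floor]; push_cast; linarith, Int.le_floor.2 h1.2⟩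
  have h1 : latticeCount parabolicRegion R ≤ T.card := by
    rw [latticeCount, ← Set.ncard_coe_finset]
    exact Set.ncard_le_ncard hsub T.finite_toSet
  have h2 : (T.card : ℝ) ≤ ∑ m ∈ Finset.Icc (-⌊R⌋) ⌊R⌋,
      (({m} ×ˢ Finset.Icc (-⌊R - (m : ℝ) ^ 2 / R⌋) ⌊R - (m : ℝ) ^ 2 / R⌋ : Finset (ℤ × ℤ)).card : ℝ) := by
    rw [← Nat.cast_sum]
    exact Nat.cast_le.2 Finset.card_biUnion_le
  refine ((Nat.cast_le.2 h1).trans h2).trans (Finset.sum_le_sum fun m hm => ?_)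
  rw [Finset.card_product, Finset.card_singleton, one_mul, Int.card_Icc]
  have ht : 0 ≤ R - (m : ℝ) ^ 2 / R := by
    rw [Finset.mem_Icc] at hm
    have a1 : (-R : ℝ) ≤ m := by
      have : (-⌊R⌋ : ℝ) ≤ m := by exact_mod_cast hm.1
      linarith [Int.floor_le R]
    have a2 : (m : ℝ) ≤ R := by
      have : (m : ℝ) ≤ ⌊R⌋ := by exact_mod_cast hm.2
      linarith [Int.floor_le R]
    rw [sub_nonneg, div_le_iff₀ hR]
    nlinarith
  have hfl : 0 ≤ ⌊R - (m : ℝ) ^ 2 / R⌋ := Int.floor_nonneg.2 ht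
  have hc : ((⌊R - (m : ℝ) ^ 2 / R⌋ + 1 - -⌊R - (m : ℝ) ^ 2 / R⌋).toNat : ℤ)
      = 2 * ⌊R - (m : ℝ) ^ 2 / R⌋ + 1 := by omega
  have hc' : ((⌊R - (m : ℝ) ^ 2 / R⌋ + 1 - -⌊R - (m : ℝ) ^ 2 / R⌋).toNat : ℝ)
      = 2 * ⌊R - (m : ℝ) ^ 2 / R⌋ + 1 := by exact_mod_cast hc
  rw [hc', sawtooth]
  have := Int.floor_add_fract (R - (m : ℝ) ^ 2 / R)
  linarith

lemma sum_sq_Icc (M : ℕ) :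
    ∑ m ∈ Finset.Icc (-(M : ℤ)) M, (m : ℝ) ^ 2 = M * (M + 1) * (2 * M + 1) / 3 := by
  induction M with
  | zero => simp
  | succ M ih =>
    have h : Finset.Icc (-((M + 1 : ℕ) : ℤ)) (M + 1 : ℕ)
        = insert (-((M : ℤ) + 1)) (insert ((M : ℤ) + 1) (Finset.Icc (-(M : ℤ)) M)) := by
      ext m; simp; omega
    rw [h, Finset.sum_insert (by simp; omega), Finset.sum_insert (by simp), ih]
    push_cast
    ring

/-- The summand vanishes at `m = ±R`, so the sum exceeds its integral, half the area of the dilated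
region, by only `O(1)`. -/
lemma sum_parabola_le {R : ℝ} (hR : 1 ≤ R) :
    ∑ m ∈ Finset.Icc (-⌊R⌋) ⌊R⌋, (R - (m : ℝ) ^ 2 / R) ≤ 4 / 3 * R ^ 2 + 1 := by
  obtain ⟨M, hM⟩ := Int.eq_ofNat_of_zero_le (Int.floor_nonneg.2 (by linarith : 0 ≤ R))
  have h1 := Int.floor_le R
  have h2 := Int.lt_floor_add_one R
  rw [hM] at h1 h2 ⊢
  rw [Int.cast_natCast] at h1 h2
  rw [Finset.sum_sub_distrib, ← Finset.sum_div, sum_sq_Icc, Finset.sum_const, Int.card_Icc,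
    nsmul_eq_mul]
  have hc : ((M : ℤ) + 1 - -M).toNat = 2 * M + 1 := by omega
  rw [hc]
  push_cast
  obtain ⟨t, ht⟩ : ∃ t : ℝ, t = R - M := ⟨_, rfl⟩
  have hMt : (M : ℝ) = R - t := by linarith
  have ht0 : 0 ≤ t := by linarith
  have ht1 : t ≤ 1 := by linarith
  rw [hMt, sub_le_iff_le_add, ← sub_le_iff_le_add', le_div_iff₀ (by linarith)]
  have h3 : 0 ≤ t * (1 - t) := mul_nonneg ht0 (by linarith)
  nlinarith [mul_nonneg ht0 h3, sq_nonneg (2 * t - 1), mul_nonneg (by linarith : 0 ≤ R) h3,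
    mul_nonneg (by linarith : 0 ≤ R) (sq_nonneg (2 * t - 1))]

/-- The two ranges differ in at most `2|M - q| + 2` terms, each at most `1/2` in size. Here `M` will
be `⌊R⌋`, within `√q + 2` of `q`. -/
lemma sum_sawtooth_change_range {R : ℝ} {q M : ℕ} :
    ∑ m ∈ Finset.Ico (-(q : ℤ)) q, sawtooth (R - m ^ 2 / R) - (|(M : ℝ) - q| + 1)
      ≤ ∑ m ∈ Finset.Icc (-(M : ℤ)) M, sawtooth (R - m ^ 2 / R) := by
  set A := Finset.Icc (-(M : ℤ)) M with hA
  set B := Finset.Ico (-(q : ℤ)) q with hB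
  set f : ℤ → ℝ := fun m => sawtooth (R - m ^ 2 / R) with hf
  have h1 : ∑ m ∈ A \ B, f m + ∑ m ∈ A ∩ B, f m = ∑ m ∈ A, f m := by
    rw [add_comm]; exact Finset.sum_inter_add_sum_sdiff A B f
  have h2 : ∑ m ∈ B \ A, f m + ∑ m ∈ A ∩ B, f m = ∑ m ∈ B, f m := by
    rw [add_comm, Finset.inter_comm]; exact Finset.sum_inter_add_sum_sdiff B A f
  have h3 : -((A \ B).card / 2 : ℝ) ≤ ∑ m ∈ A \ B, f m := by
    have := Finset.sum_le_sum (s := A \ B) (f := fun _ => (-(1 / 2) : ℝ)) (g := f)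
      fun m _ => (abs_le.1 (abs_sawtooth_le _)).1
    rw [Finset.sum_const, nsmul_eq_mul] at this
    linarith
  have h4 : ∑ m ∈ B \ A, f m ≤ (B \ A).card / 2 := by
    have := Finset.sum_le_sum (s := B \ A) (f := f) (g := fun _ => (1 / 2 : ℝ))
      fun m _ => (abs_le.1 (abs_sawtooth_le _)).2
    rw [Finset.sum_const, nsmul_eq_mul] at this
    linarith
  have h5 : (((A \ B).card : ℝ) + (B \ A).card) / 2 ≤ |(M : ℝ) - q| + 1 := by
    rcases le_total q M with h | h
    · have e1 : B \ A = ∅ := by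
        rw [Finset.sdiff_eq_empty_iff_subset]
        intro m hm
        simp only [hB, hA, Finset.mem_Ico, Finset.mem_Icc] at hm ⊢
        omega
      have e2 : A \ B ⊆ Finset.Ico (-(M : ℤ)) (-q) ∪ Finset.Icc (q : ℤ) M := by
        intro m hm
        simp only [hB, hA, Finset.mem_sdiff, Finset.mem_Ico, Finset.mem_Icc, Finset.mem_union] at hm ⊢
        omega
      have e3 := (Finset.card_le_card e2).trans (Finset.card_union_le _ _)
      rw [Int.card_Ico, Int.card_Icc] at e3
      have e4 : ((A \ B).card : ℝ) ≤ 2 * ((M : ℝ) - q) + 1 := by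
        have : ((A \ B).card : ℤ) ≤ 2 * ((M : ℤ) - q) + 1 := by omega
        exact_mod_cast this
      rw [e1, Finset.card_empty]
      have := le_abs_self ((M : ℝ) - q)
      push_cast
      linarith
    · have e1 : A \ B ⊆ {(q : ℤ)} := by
        intro m hm
        simp only [hB, hA, Finset.mem_sdiff, Finset.mem_Ico, Finset.mem_Icc,
          Finset.mem_singleton] at hm ⊢
        omega
      have e2 : B \ A ⊆ Finset.Ico (-(q : ℤ)) (-M) ∪ Finset.Ioo (M : ℤ) q := by
        intro m hm
        simp only [hB, hA, Finset.mem_sdiff, Finset.mem_Ico, Finset.mem_Icc, Finset.mem_union,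
          Finset.mem_Ioo] at hm ⊢
        omega
      have e3 := (Finset.card_le_card e2).trans (Finset.card_union_le _ _)
      rw [Int.card_Ico, Int.card_Ioo] at e3
      have e4 : ((B \ A).card : ℝ) ≤ 2 * ((q : ℝ) - M) := by
        have : ((B \ A).card : ℤ) ≤ 2 * ((q : ℤ) - M) := by omega
        exact_mod_cast this
      have e5 : ((A \ B).card : ℝ) ≤ 1 := by exact_mod_cast Finset.card_le_card e1
      have := neg_le_abs ((M : ℝ) - q)
      linarith
  linarith

/-- The lattice discrepancy of the parabolic region takes large negative values. -/
theorem exists_discrepancy_le : ∃ c C : ℝ, 0 < c ∧ 0 < C ∧ ∀ Q Y : ℕ, 16 ≤ Q → 0 < Y → Y ^ 4 ≤ Q →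
    C ≤ c * divisorSum Q Y → ∃ R : ℝ, (Q : ℝ) / 2 ≤ R ∧ R ≤ 2 * (Q * Y ^ 2) ∧
      (latticeCount parabolicRegion R : ℝ) - volume.real parabolicRegion * R ^ 2
        ≤ -(√R * (c * divisorSum Q Y - C)) := by
  obtain ⟨c, C, hc, hC, h⟩ := exists_sawtooth_sum_ge
  -- The main term and the change of range cost `2√q + 8 ≤ 10√q` in all. The factor 2 from the
  -- symmetry of the columns is spent on `√R ≤ 2√q`, so 5 suffices.
  refine ⟨c, C + 5, hc, by positivity, fun Q Y hQ hY hQY hlarge => ?_⟩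
  obtain ⟨q, hQq, hq2, R, hR, hsum⟩ := h Q Y (by omega) hY hQY (by linarith)
  have hq : (16 : ℝ) ≤ q := by exact_mod_cast hQ.trans hQq
  have hsq : √(q : ℝ) ^ 2 = q := Real.sq_sqrt (by positivity)
  have hs4 : 4 ≤ √(q : ℝ) := by
    apply Real.le_sqrt_of_sq_le; linarith
  have hsle : √(q : ℝ) + 1 ≤ q / 2 := by nlinarith
  obtain ⟨hR1, hR2⟩ := abs_le.1 hR
  have hQq' : (Q : ℝ) ≤ q := by exact_mod_cast hQq
  have hq2' : (q : ℝ) ≤ Q * Y ^ 2 := by exact_mod_cast hq2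
  have hRpos : 1 ≤ R := by linarith
  refine ⟨R, by linarith, by linarith, ?_⟩
  obtain ⟨M, hM⟩ := Int.eq_ofNat_of_zero_le (Int.floor_nonneg.2 (by linarith : 0 ≤ R))
  have f1 := Int.floor_le R
  have f2 := Int.lt_floor_add_one R
  have h1 := latticeCount_le (by linarith : 0 < R)
  have h2 := sum_parabola_le hRpos
  rw [hM] at f1 f2 h1 h2
  rw [Int.cast_natCast] at f1 f2
  rw [← Finset.mul_sum, Finset.sum_sub_distrib] at h1
  have h3 := sum_sawtooth_change_range (R := R) (q := q) (M := M)
  have h4 : |(M : ℝ) - q| ≤ √q + 2 := by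
    rw [abs_le]; constructor <;> linarith
  rw [volume_real_parabolicRegion]
  set D := c * divisorSum Q Y with hD
  have h5 : √R ≤ 2 * √q := by
    have : √(q : ℝ) * 2 = √(q * 4) := by
      rw [Real.sqrt_mul (by positivity), show (4 : ℝ) = 2 ^ 2 by norm_num, Real.sqrt_sq two_pos.le]
    rw [mul_comm, this]
    exact Real.sqrt_le_sqrt (by linarith)
  have h6 : √R * (D - (C + 5)) ≤ 2 * √q * (D - (C + 5)) :=
    mul_le_mul_of_nonneg_right h5 (by linarith)
  have h7 : 2 * √q * (D - (C + 5)) = 2 * (√q * (D - C)) - 10 * √q := by ring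
  linarith

/-! ### Divisor sums of squarefree numbers as products over primes. -/

/-- The arithmetic function `n ↦ n ^ (-1 / 2)`. -/
noncomputable def invSqrtArith : ArithmeticFunction ℝ := ⟨fun n => (√(n : ℝ))⁻¹, by simp⟩

lemma invSqrtArith_apply (n : ℕ) : invSqrtArith n = (√(n : ℝ))⁻¹ := rfl

lemma isMultiplicative_invSqrtArith : invSqrtArith.IsMultiplicative := by
  constructor
  · simp [invSqrtArith_apply]
  · intro m n _
    simp [invSqrtArith_apply, mul_comm]

lemma sum_inv_sqrt_divisors {Q : ℕ} (hQ : Squarefree Q) :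
    ∑ e ∈ Q.divisors, (√(e : ℝ))⁻¹ = ∏ p ∈ Q.primeFactors, (1 + (√(p : ℝ))⁻¹) :=
  (isMultiplicative_invSqrtArith.prodPrimeFactors_one_add_of_squarefree hQ).symm

lemma card_divisors_of_squarefree {Q : ℕ} (hQ : Squarefree Q) :
    Q.divisors.card = 2 ^ Q.primeFactors.card := by
  have h := ArithmeticFunction.isMultiplicative_zeta.prodPrimeFactors_one_add_of_squarefree hQ
  rw [Finset.card_eq_sum_ones]
  have h1 : ∑ d ∈ Q.divisors, ArithmeticFunction.zeta d = ∑ d ∈ Q.divisors, 1 :=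
    Finset.sum_congr rfl fun d hd =>
      ArithmeticFunction.zeta_apply_ne (Nat.pos_of_mem_divisors hd).ne'
  have h2 : ∏ p ∈ Q.primeFactors, (1 + ArithmeticFunction.zeta p) = ∏ p ∈ Q.primeFactors, 2 :=
    Finset.prod_congr rfl fun p hp => by
      rw [ArithmeticFunction.zeta_apply_ne (Nat.prime_of_mem_primeFactors hp).ne_zero]
  rw [← h1, ← h, h2, Finset.prod_const]

/-- With `w` prime factors there are `2^w` divisors, and each one beyond `4^w` contributes less than
`2^{-w}`. Truncation therefore loses at most 1. -/
lemma divisorSum_ge {Q : ℕ} (hQ : Squarefree Q) :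
    ∏ p ∈ Q.primeFactors, (1 + (√(p : ℝ))⁻¹) - 1 ≤ divisorSum Q (4 ^ Q.primeFactors.card) := by
  set Y := 4 ^ Q.primeFactors.card with hY
  rw [← sum_inv_sqrt_divisors hQ, divisorSum,
    ← Finset.sum_filter_add_sum_filter_not Q.divisors (· ≤ Y)]
  have h1 : ∑ e ∈ Q.divisors.filter (fun e => ¬ e ≤ Y), (√(e : ℝ))⁻¹ ≤ 1 := by
    calc _ ≤ ∑ e ∈ Q.divisors.filter (fun e => ¬ e ≤ Y), ((2 : ℝ) ^ Q.primeFactors.card)⁻¹ := by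
          refine Finset.sum_le_sum fun e he => ?_
          have he2 := (Finset.mem_filter.1 he).2
          rw [not_le] at he2
          have h3 : ((2 : ℝ) ^ Q.primeFactors.card) ≤ √(e : ℝ) := by
            apply Real.le_sqrt_of_sq_le
            rw [← pow_mul, mul_comm, pow_mul]
            norm_num
            exact_mod_cast he2.le
          exact inv_anti₀ (by positivity) h3
      _ ≤ (2 : ℝ) ^ Q.primeFactors.card * ((2 : ℝ) ^ Q.primeFactors.card)⁻¹ := by
          rw [Finset.sum_const, nsmul_eq_mul]
          gcongr
          have := (Finset.card_filter_le Q.divisors (fun e => ¬ e ≤ Y)).trans_eq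
            (card_divisors_of_squarefree hQ)
          exact_mod_cast this
      _ = 1 := mul_inv_cancel₀ (by positivity)
  linarith

lemma sub_sq_half_le_log {x : ℝ} (hx : 0 ≤ x) : x - x ^ 2 / 2 ≤ Real.log (1 + x) := by
  refine le_trans ?_ (Real.le_log_one_add_of_nonneg hx)
  rw [le_div_iff₀ (by positivity)]
  nlinarith [pow_nonneg hx 3]

/-- The quadratic term of the logarithm is half of `∑ 1/p`; bounding it by the harmonic sum is
harmless beside a main term of order `√N / log N`. -/
lemma exp_le_prod_one_add (N : ℕ) :
    Real.exp (∑ p ∈ N.primesLE, (√(p : ℝ))⁻¹ - (1 + Real.log N) / 2)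
      ≤ ∏ p ∈ N.primesLE, (1 + (√(p : ℝ))⁻¹) := by
  have hpos : ∀ p ∈ N.primesLE, (0 : ℝ) < 1 + (√(p : ℝ))⁻¹ := fun p _ => by positivity
  rw [← Real.exp_log (Finset.prod_pos hpos), Real.log_prod fun p hp => (hpos p hp).ne']
  apply Real.exp_le_exp.2
  have h1 : ∑ p ∈ N.primesLE, (((√(p : ℝ))⁻¹) - ((√(p : ℝ))⁻¹) ^ 2 / 2)
      ≤ ∑ p ∈ N.primesLE, Real.log (1 + (√(p : ℝ))⁻¹) :=
    Finset.sum_le_sum fun p _ => sub_sq_half_le_log (by positivity)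
  rw [Finset.sum_sub_distrib, ← Finset.sum_div] at h1
  have h2 : ∑ p ∈ N.primesLE, ((√(p : ℝ))⁻¹) ^ 2 ≤ 1 + Real.log N := by
    have h3 := harmonic_le_one_add_log N
    rw [harmonic_eq_sum_Icc] at h3
    push_cast at h3
    refine le_trans ?_ h3
    calc _ = ∑ p ∈ N.primesLE, ((p : ℝ))⁻¹ := Finset.sum_congr rfl fun p _ => by
          rw [inv_pow, Real.sq_sqrt (by positivity)]
      _ ≤ _ := Finset.sum_le_sum_of_subset_of_nonneg (fun p hp => by
          have := Nat.mem_primesLE.1 hp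
          rw [Finset.mem_Icc]
          exact ⟨this.2.one_le, this.1⟩) fun _ _ _ => by positivity
  linarith

/-- Partial summation against a lower bound for Chebyshev's function. -/
lemma sum_log_div_sqrt_ge {a A : ℝ} (ha : 0 ≤ a)
    (hθ : ∀ n : ℕ, 1 ≤ n → a * (n + 1 / 2) ≤ Chebyshev.theta n + A) (N : ℕ) (hN : 1 ≤ N) :
    (Chebyshev.theta N + A) / √N + a * √N - (A + a)
      ≤ ∑ p ∈ N.primesLE, Real.log p * (√(p : ℝ))⁻¹ := by
  induction N, hN using Nat.le_induction with
  | base => simp [Nat.primesLE_one]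
  | succ N hN ih =>
    have hN' : (1 : ℝ) ≤ N := by exact_mod_cast hN
    have hstep : ∑ p ∈ (N + 1).primesLE, Real.log p * (√(p : ℝ))⁻¹
        - ∑ p ∈ N.primesLE, Real.log p * (√(p : ℝ))⁻¹
        = (Chebyshev.theta (N + 1 : ℕ) - Chebyshev.theta N) / √(N + 1 : ℕ) := by
      rw [Chebyshev.theta_eq_sum_primesLE_log, Chebyshev.theta_eq_sum_primesLE_log]
      simp only [Nat.primesLE, Nat.primesBelow]
      rw [Finset.range_add_one (n := N + 1), Finset.filter_insert]
      split_ifs with h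
      · rw [Finset.sum_insert (by simp), Finset.sum_insert (by simp)]
        rw [div_eq_mul_inv]
        ring
      · simp
    have hs0 : 0 < √(N : ℝ) := by positivity
    have hs1 : 0 < √((N + 1 : ℕ) : ℝ) := by positivity
    set s := √(N : ℝ) with hs
    set t := √((N + 1 : ℕ) : ℝ) with ht
    have e1 : s ^ 2 = N := Real.sq_sqrt (by positivity)
    have e2 : t ^ 2 = N + 1 := by rw [ht, Real.sq_sqrt (by positivity)]; push_cast; rfl
    have hst : s ≤ t := Real.sqrt_le_sqrt (by push_cast; linarith)
    have h1 := hθ N hN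
    -- `√(N(N+1)) ≤ N + 1/2` is the reason for the `1/2` in the hypothesis: the increments of `a√N`
    -- then telescope exactly.
    have h2 : a * (s * t) ≤ Chebyshev.theta N + A := by
      refine le_trans ?_ h1
      gcongr
      nlinarith [sq_nonneg (t - s)]
    have h3 : a * (t - s) ≤ (Chebyshev.theta N + A) * (s⁻¹ - t⁻¹) := by
      have e3 : s⁻¹ - t⁻¹ = (t - s) / (s * t) := by field_simp
      rw [e3, mul_div_assoc', le_div_iff₀ (by positivity)]
      nlinarith [mul_le_mul_of_nonneg_right h2 (sub_nonneg.2 hst)]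
    simp only [div_eq_mul_inv] at ih hstep ⊢
    linarith

/-- Arithmetic-geometric mean, used with `s = √N` and `T` essentially `θ(N)`. It expresses the bound
through `√θ(N)` alone, so that no upper bound for `θ` is required. -/
lemma two_sqrt_mul_le {a T s : ℝ} (hT : 0 ≤ T) (hs : 0 < s) :
    2 * (a * √T) ≤ T / s + a ^ 2 * s := by
  have h := Real.sq_sqrt hT
  rw [div_add' _ _ _ hs.ne', le_div_iff₀ hs]
  nlinarith [sq_nonneg (√T - a * s)]

/-! ### Chebyshev bounds and the choice of a primorial. -/

lemma eventually_log_le_rpow {ε b : ℝ} (hε : 0 < ε) (hb : 0 < b) :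
    ∀ᶠ N : ℕ in atTop, Real.log N ≤ b * (N : ℝ) ^ ε := by
  have h := (isLittleO_log_rpow_atTop hε).bound hb
  have h2 := tendsto_natCast_atTop_atTop (R := ℝ) |>.eventually h
  filter_upwards [h2] with N hN
  rw [Real.norm_eq_abs, Real.norm_of_nonneg (by positivity)] at hN
  exact (le_abs_self _).trans hN

lemma eventually_theta_ge {a : ℝ} (ha : a < Real.log 2) :
    ∀ᶠ N : ℕ in atTop, a * N ≤ Chebyshev.theta N := by
  set δ := (Real.log 2 - a) / 4 with hδ
  have hδ0 : 0 < δ := by rw [hδ]; linarith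
  filter_upwards [eventually_log_le_rpow (ε := 1 / 2) (b := δ) (by norm_num) hδ0,
    eventually_ge_atTop ⌈Real.log 2 / δ⌉₊, eventually_ge_atTop 1] with N h2 h6 hN
  have hN' : (1 : ℝ) ≤ N := by exact_mod_cast hN
  have h3 := Chebyshev.theta_ge N
  have h4 : Real.log (N + 1) ≤ Real.log 2 + Real.log N := by
    rw [← Real.log_mul (by norm_num) (by positivity)]
    exact Real.log_le_log (by positivity) (by linarith)
  rw [← Real.sqrt_eq_rpow] at h2
  have hs : 1 ≤ √(N : ℝ) := Real.one_le_sqrt.2 hN'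
  have e := Real.mul_self_sqrt (show (0 : ℝ) ≤ N by positivity)
  have h5 : √(N : ℝ) * Real.log N ≤ √N * (δ * √N) := by gcongr
  have h7 : Real.log 2 ≤ δ * N := by
    have := (Nat.le_ceil _).trans (Nat.cast_le (α := ℝ).2 h6)
    rw [div_le_iff₀ hδ0] at this
    linarith
  have h8 : δ * √(N : ℝ) ≤ δ * N := by gcongr; nlinarith
  have h9 : Real.log 2 = a + 4 * δ := by rw [hδ]; ring
  nlinarith

/-- Makes `Y = 4^π(N)` a negligible power of the primorial, so that `log R` stays close to `θ(N)`.
-/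
lemma eventually_card_primesLE_le {δ : ℝ} (hδ : 0 < δ) :
    ∀ᶠ N : ℕ in atTop, (N.primesLE.card : ℝ) ≤ δ * N := by
  have h := tendsto_natCast_atTop_atTop (R := ℝ) |>.eventually
    (Chebyshev.eventually_primeCounting_le one_pos)
  have hlog : Tendsto (fun N : ℕ => Real.log N) atTop atTop :=
    Real.tendsto_log_atTop.comp tendsto_natCast_atTop_atTop
  filter_upwards [h, hlog.eventually_ge_atTop ((Real.log 4 + 1) / δ),
    hlog.eventually_ge_atTop 1] with N h1 h2 h3
  rw [Nat.floor_natCast] at h1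
  have e : (N.primesLE.card : ℝ) = Nat.primeCounting N := by
    rw [Nat.primesLE_card_eq_primeCounting]
  rw [e]
  refine h1.trans ?_
  rw [div_le_iff₀ (by linarith)]
  rw [div_le_iff₀ hδ] at h2
  have : (0 : ℝ) ≤ N := by positivity
  nlinarith


lemma exists_theta_ge {a : ℝ} (ha0 : 0 ≤ a) (ha : a < Real.log 2) :
    ∃ A, 0 ≤ A ∧ ∀ n : ℕ, a * (n + 1 / 2) ≤ Chebyshev.theta n + A := by
  obtain ⟨N, hN⟩ := eventually_atTop.1 (eventually_theta_ge ha)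
  refine ⟨a * (N + 1 / 2), by positivity, fun n => ?_⟩
  rcases le_total N n with h | h
  · have := hN n h
    have : 0 ≤ a * N := by positivity
    linarith
  · have h1 : a * (n + 1 / 2) ≤ a * (N + 1 / 2) := by gcongr
    linarith [Chebyshev.theta_nonneg (n : ℝ)]

/-- The factor 1.6 is `2 · 0.8`, where `0.8² = 0.64 < log 2` is an admissible Chebyshev constant;
`log p` is bounded by `log N`. -/
lemma exists_log_mul_sum_inv_sqrt_ge : ∃ B : ℝ, 0 ≤ B ∧ ∀ N : ℕ, 1 ≤ N →
    1.6 * √(Chebyshev.theta N) - B ≤ Real.log N * ∑ p ∈ N.primesLE, (√(p : ℝ))⁻¹ := by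
  obtain ⟨A, hA, h⟩ := exists_theta_ge (a := 0.8 ^ 2) (by norm_num)
    (by linarith [Real.log_two_gt_d9])
  refine ⟨A + 0.8 ^ 2, by positivity, fun N hN => ?_⟩
  have h1 := sum_log_div_sqrt_ge (by norm_num) (fun n _ => h n) N hN
  have hN' : (0 : ℝ) < N := by exact_mod_cast hN
  have h2 := two_sqrt_mul_le (a := 0.8) (T := Chebyshev.theta N + A) (s := √N)
    (by linarith [Chebyshev.theta_nonneg (N : ℝ)]) (Real.sqrt_pos.2 hN')
  have h3 : √(Chebyshev.theta N) ≤ √(Chebyshev.theta N + A) := Real.sqrt_le_sqrt (by linarith)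
  have h4 : ∑ p ∈ N.primesLE, Real.log p * (√(p : ℝ))⁻¹
      ≤ Real.log N * ∑ p ∈ N.primesLE, (√(p : ℝ))⁻¹ := by
    rw [Finset.mul_sum]
    refine Finset.sum_le_sum fun p hp => ?_
    have h5 := Nat.mem_primesLE.1 hp
    gcongr
    exacts [Nat.cast_pos.2 h5.2.pos, h5.1]
  linarith

lemma eventually_log_sq_le {η : ℝ} (hη : 0 < η) :
    ∀ᶠ N : ℕ in atTop, Real.log N ^ 2 ≤ η * √N := by
  filter_upwards [eventually_log_le_rpow (ε := 1 / 4) (b := √η) (by norm_num)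
    (Real.sqrt_pos.2 hη), eventually_ge_atTop 1] with N h hN
  have hN' : (1 : ℝ) ≤ N := by exact_mod_cast hN
  calc Real.log N ^ 2 ≤ (√η * (N : ℝ) ^ (1 / 4 : ℝ)) ^ 2 := by
        gcongr
    _ = η * √N := by
        rw [mul_pow, Real.sq_sqrt hη.le, Real.sqrt_eq_rpow, ← Real.rpow_mul_natCast (by positivity)]
        norm_num

/-- The divisor sum of a primorial is large. -/
lemma eventually_exp_le_divisorSum_primorial (K : ℝ) : ∀ᶠ N : ℕ in atTop,
    Real.exp (1.53 * (√(Chebyshev.theta N) / Real.log N) + K) - 1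
      ≤ divisorSum (primorial N) (4 ^ N.primesLE.card) := by
  obtain ⟨B, hB, hsum⟩ := exists_log_mul_sum_inv_sqrt_ge
  have hlog : Tendsto (fun N : ℕ => Real.log N) atTop atTop :=
    Real.tendsto_log_atTop.comp tendsto_natCast_atTop_atTop
  -- The slack between 1.6 and 1.53 is worth `0.07 √θ(N) ≥ 0.07 · 0.8 √N = 0.056 √N`, which absorbs
  -- all terms of size at most `log² N`.
  filter_upwards [eventually_log_sq_le (η := 0.056 / (B + 1 + |K|)) (by positivity),
    eventually_theta_ge (a := 0.64) (by linarith [Real.log_two_gt_d9]),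
    hlog.eventually_ge_atTop 1, eventually_ge_atTop 1] with N h1 h2 hL hN
  have h3 := divisorSum_ge (squarefree_primorial N)
  rw [primeFactors_primorial] at h3
  refine le_trans ?_ h3
  gcongr
  refine le_trans ?_ (exp_le_prod_one_add N)
  apply Real.exp_le_exp.2
  have h4 := hsum N hN
  set L := Real.log N
  set S := ∑ p ∈ N.primesLE, (√(p : ℝ))⁻¹
  have h5 : 0.8 * √(N : ℝ) ≤ √(Chebyshev.theta N) := by
    apply Real.le_sqrt_of_sq_le
    rw [mul_pow, Real.sq_sqrt (by positivity)]
    linarith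
  have h6 : L ^ 2 * (B + 1 + |K|) ≤ 0.056 * √N := by
    rw [div_mul_eq_mul_div, le_div_iff₀ (by positivity)] at h1
    exact h1
  have hL2 : L ≤ L ^ 2 := by nlinarith
  have h7 : B + L * K + L * ((1 + L) / 2) ≤ L ^ 2 * (B + 1 + |K|) := by
    have : L * K ≤ L ^ 2 * |K| :=
      (mul_le_mul_of_nonneg_left (le_abs_self K) (by linarith)).trans
        (mul_le_mul_of_nonneg_right hL2 (abs_nonneg K))
    nlinarith
  set W := √(Chebyshev.theta N)
  have hL0 : 0 < L := by linarith
  have h8 : L * (1.53 * (W / L) + K) ≤ L * (S - (1 + L) / 2) := by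
    have : L * (1.53 * (W / L) + K) = 1.53 * W + L * K := by field_simp
    rw [this]
    linarith
  exact le_of_mul_le_mul_left h8 hL0

/-- The size of the radii attached to a primorial. -/
lemma eventually_primorial_bounds : ∀ᶠ N : ℕ in atTop,
    ((4 ^ N.primesLE.card) ^ 4 ≤ primorial N) ∧
    ∀ R : ℝ, (primorial N : ℝ) / 2 ≤ R →
      R ≤ 2 * (primorial N * ((4 ^ N.primesLE.card : ℕ) : ℝ) ^ 2) →
      Real.log R ≤ 1.05 * Chebyshev.theta N ∧ 0.95 * Real.log N ≤ Real.log (Real.log R) := by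
  have hlog : Tendsto (fun N : ℕ => Real.log N) atTop atTop :=
    Real.tendsto_log_atTop.comp tendsto_natCast_atTop_atTop
  -- The factor `Y²` adds `4 π(N) log 2 ≤ 0.014 N` to `log R`, within the slack `0.05 θ(N) ≥ 0.032
  -- N`; `log N ≥ 20` gives `log(N/2) ≥ 0.95 log N`.
  filter_upwards [eventually_card_primesLE_le (δ := 0.005) (by norm_num),
    eventually_theta_ge (a := 0.64) (by linarith [Real.log_two_gt_d9]),
    hlog.eventually_ge_atTop 20, eventually_ge_atTop 100] with N h1 h2 hL hN
  have hN' : (100 : ℝ) ≤ N := by exact_mod_cast hN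
  have hQ : (0 : ℝ) < primorial N := by exact_mod_cast primorial_pos N
  have hθ : Chebyshev.theta N = Real.log (primorial N) := by
    rw [Chebyshev.theta_eq_log_primorial, Nat.floor_natCast]
  have h4 : Real.log 4 = 2 * Real.log 2 := by
    rw [show (4 : ℝ) = 2 ^ 2 by norm_num, Real.log_pow]; norm_num
  have hl := Real.log_two_lt_d9
  have hl' := Real.log_two_gt_d9
  set w := N.primesLE.card
  have hw : (0 : ℝ) ≤ w := by positivity
  have hw2 : w * Real.log 2 ≤ 0.005 * N * 0.7 := by
    gcongr
    linarith
  refine ⟨?_, fun R hR1 hR2 => ⟨?_, ?_⟩⟩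
  · have : Real.log (((4 : ℝ) ^ w) ^ 4) ≤ Real.log (primorial N) := by
      rw [← hθ, Real.log_pow, Real.log_pow, h4]
      push_cast
      linarith
    have h5 := (Real.log_le_log_iff (by positivity) hQ).1 this
    exact_mod_cast h5
  · have hR0 : 0 < R := by linarith
    refine (Real.log_le_log hR0 hR2).trans ?_
    push_cast
    rw [Real.log_mul (by norm_num) (by positivity), Real.log_mul (by positivity) (by positivity),
      ← hθ, Real.log_pow, Real.log_pow, h4]
    push_cast
    linarith
  · have h5 : (N : ℝ) / 2 ≤ Real.log R := by
      refine le_trans ?_ (Real.log_le_log (by positivity) hR1)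
      rw [Real.log_div (by positivity) (by norm_num), ← hθ]
      linarith
    refine le_trans ?_ (Real.log_le_log (by positivity) h5)
    rw [Real.log_div (by positivity) (by norm_num)]
    linarith

/-- Numerically `√2 · √1.05 ≤ 1.4535 = 1.53 · 0.95`, so 1.53 covers every `c ≤ √2` after the losses
in `log R` and `log log R`. -/
lemma mul_sqrt_log_div_le {c r T L : ℝ} (hc : c ≤ √2) (hT0 : 0 ≤ T) (hT : r ≤ 1.05 * T) (hL : 0 < L)
    (h : 0.95 * L ≤ Real.log r) :
    c * √r / Real.log r ≤ 1.53 * (√T / L) := by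
  have h1 : 0 < Real.log r := by linarith
  rw [mul_div_assoc]
  have h2 : √2 * √r ≤ 1.4535 * √T := by
    rw [← Real.sqrt_mul (by norm_num)]
    calc √(2 * r) ≤ √(1.4535 ^ 2 * T) := by
          apply Real.sqrt_le_sqrt
          nlinarith
      _ = _ := by rw [Real.sqrt_mul (by norm_num), Real.sqrt_sq (by norm_num)]
  calc c * (√r / Real.log r) ≤ √2 * (√r / Real.log r) := by gcongr
    _ = √2 * √r / Real.log r := by ring
    _ ≤ 1.4535 * √T / (0.95 * L) := by gcongr
    _ = _ := by field_simp; ring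

/-! ### Conclusion. -/

theorem mainTheorem6 (c : ℝ) (hc : c < Real.sqrt 2) :
    IsOmegaMinus
      (fun R : ℝ => (latticeCount parabolicRegion R : ℝ) - volume.real parabolicRegion * R ^ 2)
      (fun R : ℝ => R ^ (1 / 2 : ℝ) *
        Real.exp (c * Real.sqrt (Real.log R) / Real.log (Real.log R))) := by
  intro hlittle
  obtain ⟨c₀, C, hc₀, hC, hcore⟩ := exists_discrepancy_le
  obtain ⟨R₀, hR₀⟩ := eventually_atTop.1 (hlittle.bound one_pos)
  have hlog : Tendsto (fun N : ℕ => Real.log N) atTop atTop :=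
    Real.tendsto_log_atTop.comp tendsto_natCast_atTop_atTop
  -- The additive constant in the exponent is chosen so that `c₀ D - C` is at least twice `exp(1.53
  -- U)`; this contradicts the little-o bound taken with constant 1.
  obtain ⟨N, hdiv, ⟨hY, hbd⟩, hN, hN', hL⟩ :=
    ((eventually_exp_le_divisorSum_primorial (Real.log ((2 + c₀ + C) / c₀))).and
      (eventually_primorial_bounds.and
        ((tendsto_natCast_atTop_atTop (R := ℝ) |>.eventually_ge_atTop (2 * R₀)).and
          ((eventually_ge_atTop 16).and (hlog.eventually_gt_atTop 0))))).exists
  set U := √(Chebyshev.theta N) / Real.log N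
  rw [Real.exp_add, Real.exp_log (by positivity)] at hdiv
  set D := divisorSum (primorial N) (4 ^ N.primesLE.card)
  have hU : 0 ≤ U := by positivity
  have hE : 1 ≤ Real.exp (1.53 * U) := Real.one_le_exp (by positivity)
  have hD : 2 * Real.exp (1.53 * U) ≤ c₀ * D - C := by
    have h1 : c₀ * (Real.exp (1.53 * U) * ((2 + c₀ + C) / c₀) - 1)
        = Real.exp (1.53 * U) * (2 + c₀ + C) - c₀ := by field_simp
    have h2 := mul_le_mul_of_nonneg_left hdiv hc₀.le
    rw [h1] at h2
    nlinarith
  obtain ⟨R, hR1, hR2, hR⟩ := hcore (primorial N) (4 ^ N.primesLE.card)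
    (hN'.trans le_primorial_self) (by positivity) hY (by linarith)
  have hNQ : (N : ℝ) ≤ primorial N := by exact_mod_cast le_primorial_self
  have hRpos : 0 < R := by
    have : (16 : ℝ) ≤ N := by exact_mod_cast hN'
    linarith
  obtain ⟨h1, h2⟩ := hbd R hR1 hR2
  have h3 := mul_sqrt_log_div_le hc.le (Chebyshev.theta_nonneg _) h1 hL h2
  have h4 := hR₀ R (by linarith)
  have hs : 0 < √R := Real.sqrt_pos.2 hRpos
  rw [one_mul, Real.norm_of_nonneg (negPart_nonneg _), Real.norm_of_nonneg (by positivity),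
    ← Real.sqrt_eq_rpow] at h4
  have h5 := (neg_le_negPart _).trans h4
  have h6 : √R * Real.exp (c * √(Real.log R) / Real.log (Real.log R))
      ≤ √R * Real.exp (1.53 * U) := by gcongr
  have h7 := mul_le_mul_of_nonneg_left hD hs.le
  have h8 : 0 < √R * Real.exp (1.53 * U) := by positivity
  linarith
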